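/- All dg-categories are small and over $\mathbb{C}$, with $|{\rm d}|=1$. For a dg-category $\mathcal{C}$ let $D(\mathcal{C}\text{-bimod})$ be the derived category of dg-bimodules $M(X,Y)$ (contravariant in $X$, covariant in $Y$). Endofunctors $\phi$ of $\mathcal{C}$ are regarded as quasi-functors, i.e. as the bimodules $\mathcal{C}(X,\phi Y)$, and their morphisms are the morphisms in $D(\mathcal{C}\text{-bimod})$; thus $\mathrm{HH}^k(\mathcal{C},\phi)=\mathrm{Hom}(\mathrm{id}_{\mathcal{C}},\phi[k])$. A Serre functor on $\mathcal{C}$, where all $H^i\mathcal{C}(X,Y)$ are finite-dimensional, is an autoequivalence $S$ in this sense with a binatural isomorphism $\mathcal{C}(X,SY)\cong\mathcal{C}(Y,X)^\vee$ in $D(\mathcal{C}\text{-bimod})$, and then $\mathrm{HH}_\bullet(\mathcal{C})=\mathrm{HH}^\bullet(\mathcal{C},S)$. An autoequivalence $F$ of $\mathcal C$ acts on $\mathrm{HH}_\bullet(\mathcal{C})$ by conjugation, $F_*a=FaF^{-1}$, where $FSF^{-1}\cong S$ is the canonical isomorphism induced by Serre duality. $\mathcal{C}$ is Calabi--Yau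 of dimension $n$ if it is pre-triangulated (it has a zero object, all shifts, and cones of closed degree-$0$ morphisms, each determined up to closed isomorphism of degree $0$ by its structure maps) and has a Serre functor $S$ and an isomorphism $a\colon \mathrm{id}_{\mathcal{C}}\to S[-n]$. Let a finite group $G$ act on a pre-triangulated dg-category $\mathcal{C}$ by dg-autoequivalences $\rho_g$ and closed degree-$0$ isomorphisms of dg-functors $\theta_{g,h}\colon\rho_g\rho_h\to\rho_{gh}$ satisfying the associativity constraint. Let $\mathcal{C}_G$ be the dg-category of pairs $(E,\phi)$, with $\phi_g\colon E\to\rho_gE$ closed isomorphisms of degree $0$ such that $\phi_{gh}=\theta_{g,h}\circ\rho_g\phi_h\circ\phi_g$, whose morphism complexes are the subcomplexes of $G$-invariant morphisms. Each character $\chi\in G^\vee=\mathrm{Hom}(G,\mathbb{C}^*)$ acts on $\mathcal{C}_G$ by $(E,\phi)\mapsto(E,\chi\phi)$ and by the identity on morphisms. Suppose that $\mathcal{C}$ is Calabi--Yau of dimension $n$, with Serre functor $S$ and isomorphism $a\colon\mathrm{id}_{\mathcal{C}}\to S[-n]$, and that the class $a\in\mathrm{HH}_\bullet(\mathcal{C})$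 is invariant under $G$. Then $\mathcal{C}_G$ is Calabi--Yau of dimension $n$. Moreover, for every Serre functor $\tilde S$ on $\mathcal{C}_G$, let $\tilde a\colon\mathrm{id}_{\mathcal{C}_G}\to\tilde S[-n]$ be the class induced by $a$, that is, the composite $$\mathcal{C}_G(A,B)\to\mathcal{C}(A,B)\xrightarrow{\,a\,}\mathcal{C}(A,SB)[-n]\cong\mathcal{C}(B,A)^\vee[-n]\to\mathcal{C}_G(B,A)^\vee[-n]\cong\mathcal{C}_G(A,\tilde SB)[-n],$$ where the first arrow is the inclusion and the fourth its dual. Then $\tilde a$ is an isomorphism, and it is fixed by the conjugation action of $G^\vee$ on $\mathrm{HH}_\bullet(\mathcal{C}_G)$. -/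

import Mathlib

open CategoryTheory

universe u

noncomputable section

namespace DG

/-- Cochain complexes of complex vector spaces. -/
abbrev Cx : Type (u + 1) := CochainComplex (ModuleCat.{u} ℂ) ℤ

/-- A small dg-category over `ℂ`. Composition `comp h g f` is `g ∘ f`, of degree `k = |g| + |f|`,
and satisfies `d (g ∘ f) = dg ∘ f + (-1) ^ |g| g ∘ df`. -/
class DGCategory (C : Type u) where
  hom : C → C → Cx.{u}
  one (X : C) : (hom X X).X 0
  comp {X Y Z : C} {i j k : ℤ} (h : i + j = k) :
    (hom Y Z).X i →ₗ[ℂ] (hom X Y).X j →ₗ[ℂ] (hom X Z).X k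
  one_comp {X Y : C} {i : ℤ} (f : (hom X Y).X i) : comp (zero_add i) (one Y) f = f
  comp_one {X Y : C} {i : ℤ} (f : (hom X Y).X i) : comp (add_zero i) f (one X) = f
  assoc {X Y Z T : C} {a b c ab bc abc : ℤ} (h₁ : a + b = ab) (h₂ : b + c = bc)
    (h₃ : ab + c = abc) (h₄ : a + bc = abc)
    (h : (hom Z T).X a) (g : (hom Y Z).X b) (f : (hom X Y).X c) :
    comp h₃ (comp h₁ h g) f = comp h₄ h (comp h₂ g f)
  d_one (X : C) : ((hom X X).d 0 1).hom (one X) = 0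
  leibniz {X Y Z : C} {i j k i' j' k' : ℤ} (h : i + j = k) (h₁ : i' + j = k') (h₂ : i + j' = k')
    (hi : i + 1 = i') (hj : j + 1 = j') (g : (hom Y Z).X i) (f : (hom X Y).X j) :
    ((hom X Z).d k k').hom (comp h g f) =
      comp h₁ (((hom Y Z).d i i').hom g) f +
        i.negOnePow • comp h₂ g (((hom X Y).d j j').hom f)

open DGCategory

/-- An isomorphism in the dg-sense: a closed morphism of degree `0` with a two-sided inverse
(which is then closed as well). -/
def IsDGIso {C : Type u} [DGCategory C] {X Y : C} (f : (hom X Y).X 0) : Prop :=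
  ((hom X Y).d 0 1).hom f = 0 ∧
    ∃ g : (hom Y X).X 0, comp (add_zero 0) g f = one X ∧ comp (add_zero 0) f g = one Y

/-- A (strongly) pre-triangulated dg-category: it has a zero object, all shifts
(`Y` is `X[-k]` when there are mutually inverse closed morphisms `s : X → Y` of degree `k` and
`t : Y → X` of degree `-k`) and the cone `Z` of every closed morphism `f` of degree `0`,
with its structure maps `Y → Z → Y`, `X → Z → X`. -/
structure IsPretriangulated (C : Type u) [DGCategory C] : Prop where
  zero : ∃ Z : C, one Z = 0
  shift (X : C) (k : ℤ) : ∃ (Y : C) (s : (hom X Y).X k) (t : (hom Y X).X (-k)),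
    ((hom X Y).d k (k + 1)).hom s = 0 ∧ ((hom Y X).d (-k) (-k + 1)).hom t = 0 ∧
      comp (neg_add_cancel k) t s = one X ∧ comp (add_neg_cancel k) s t = one Y
  cone {X Y : C} (f : (hom X Y).X 0) (_ : ((hom X Y).d 0 1).hom f = 0) :
    ∃ (Z : C) (i : (hom Y Z).X 0) (q : (hom Z Y).X 0) (j : (hom X Z).X (-1)) (p : (hom Z X).X 1),
      comp (add_zero 0) q i = one Y ∧ comp (add_neg_cancel 1) p j = one X ∧
      comp (add_zero 1) p i = 0 ∧ comp (zero_add (-1)) q j = 0 ∧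
      comp (add_zero 0) i q + comp (neg_add_cancel 1) j p = one Z ∧
      ((hom Y Z).d 0 1).hom i = 0 ∧
      ((hom X Z).d (-1) 0).hom j = comp (add_zero 0) i f

/-- A dg-functor. -/
structure DGFunctor (C D : Type u) [DGCategory C] [DGCategory D] where
  obj : C → D
  map (X Y : C) : hom X Y ⟶ hom (obj X) (obj Y)
  map_one (X : C) : ((map X X).f 0).hom (one X) = one (obj X)
  map_comp {X Y Z : C} {i j k : ℤ} (h : i + j = k) (g : (hom Y Z).X i) (f : (hom X Y).X j) :
    ((map X Z).f k).hom (comp h g f) = comp h (((map Y Z).f i).hom g) (((map X Y).f j).hom f)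

/-- A dg-functor is a dg-equivalence if it is fully faithful and every object is dg-isomorphic
to an object in the image. -/
structure DGFunctor.IsEquiv {C D : Type u} [DGCategory C] [DGCategory D] (F : DGFunctor C D) :
    Prop where
  isIso_map (X Y : C) : IsIso (F.map X Y)
  essSurj (Y : D) : ∃ (X : C) (f : (hom (F.obj X) Y).X 0), IsDGIso f

/-! ### Bimodules and their derived category -/

/-- A dg-bimodule over `C`: complexes `M(X, Y)`, contravariant in `X` and covariant in `Y`. -/
structure DGBimod (C : Type u) [DGCategory C] where
  obj : C → C → Cx.{u}
  lact {X Y Z : C} {i j k : ℤ} (h : i + j = k) :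
    (hom Y Z).X i →ₗ[ℂ] (obj X Y).X j →ₗ[ℂ] (obj X Z).X k
  ract {X Y Z : C} {i j k : ℤ} (h : i + j = k) :
    (obj Y Z).X i →ₗ[ℂ] (hom X Y).X j →ₗ[ℂ] (obj X Z).X k
  one_lact {X Y : C} {i : ℤ} (m : (obj X Y).X i) : lact (zero_add i) (one Y) m = m
  ract_one {X Y : C} {i : ℤ} (m : (obj X Y).X i) : ract (add_zero i) m (one X) = m
  lact_comp {X Y Z T : C} {a b c ab bc abc : ℤ} (h₁ : a + b = ab) (h₂ : b + c = bc)
    (h₃ : ab + c = abc) (h₄ : a + bc = abc)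
    (h : (hom Z T).X a) (g : (hom Y Z).X b) (m : (obj X Y).X c) :
    lact h₃ (comp h₁ h g) m = lact h₄ h (lact h₂ g m)
  lact_ract {X Y Z T : C} {a b c ab bc abc : ℤ} (h₁ : a + b = ab) (h₂ : b + c = bc)
    (h₃ : ab + c = abc) (h₄ : a + bc = abc)
    (g : (hom Z T).X a) (m : (obj Y Z).X b) (f : (hom X Y).X c) :
    ract h₃ (lact h₁ g m) f = lact h₄ g (ract h₂ m f)
  ract_comp {X Y Z T : C} {a b c ab bc abc : ℤ} (h₁ : a + b = ab) (h₂ : b + c = bc)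
    (h₃ : ab + c = abc) (h₄ : a + bc = abc)
    (m : (obj Z T).X a) (g : (hom Y Z).X b) (f : (hom X Y).X c) :
    ract h₃ (ract h₁ m g) f = ract h₄ m (comp h₂ g f)
  lact_leibniz {X Y Z : C} {i j k i' j' k' : ℤ} (h : i + j = k) (h₁ : i' + j = k')
    (h₂ : i + j' = k') (hi : i + 1 = i') (hj : j + 1 = j')
    (g : (hom Y Z).X i) (m : (obj X Y).X j) :
    ((obj X Z).d k k').hom (lact h g m) =
      lact h₁ (((hom Y Z).d i i').hom g) m +
        i.negOnePow • lact h₂ g (((obj X Y).d j j').hom m)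
  ract_leibniz {X Y Z : C} {i j k i' j' k' : ℤ} (h : i + j = k) (h₁ : i' + j = k')
    (h₂ : i + j' = k') (hi : i + 1 = i') (hj : j + 1 = j')
    (m : (obj Y Z).X i) (f : (hom X Y).X j) :
    ((obj X Z).d k k').hom (ract h m f) =
      ract h₁ (((obj Y Z).d i i').hom m) f +
        i.negOnePow • ract h₂ m (((hom X Y).d j j').hom f)

namespace DGBimod

/-- Morphisms of dg-bimodules: closed of degree `0`. -/
@[ext]
structure Hom {C : Type u} [DGCategory C] (M N : DGBimod C) where
  app (X Y : C) : M.obj X Y ⟶ N.obj X Y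
  map_lact {X Y Z : C} {i j k : ℤ} (h : i + j = k) (g : (hom Y Z).X i) (m : (M.obj X Y).X j) :
    ((app X Z).f k).hom (M.lact h g m) = N.lact h g (((app X Y).f j).hom m)
  map_ract {X Y Z : C} {i j k : ℤ} (h : i + j = k) (m : (M.obj Y Z).X i) (f : (hom X Y).X j) :
    ((app X Z).f k).hom (M.ract h m f) = N.ract h (((app Y Z).f i).hom m) f

instance (C : Type u) [DGCategory C] : Category (DGBimod C) where
  Hom := Hom
  id M := { app := fun _ _ => 𝟙 _, map_lact := by intros; rfl, map_ract := by intros; rfl }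
  comp α β :=
    { app := fun X Y => α.app X Y ≫ β.app X Y
      map_lact := by intros; simp [α.map_lact, β.map_lact]
      map_ract := by intros; simp [α.map_ract, β.map_ract] }
  id_comp _ := by apply Hom.ext; funext X Y; exact Category.id_comp _
  comp_id _ := by apply Hom.ext; funext X Y; exact Category.comp_id _
  assoc _ _ _ := by apply Hom.ext; funext X Y; exact Category.assoc _ _ _

/-- Quasi-isomorphisms of dg-bimodules. -/
def quasiIso (C : Type u) [DGCategory C] : MorphismProperty (DGBimod C) :=
  fun _ _ α => ∀ X Y : C, QuasiIso (α.app X Y)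

/-- The derived category of dg-bimodules over `C`. -/
abbrev Derived (C : Type u) [DGCategory C] := (quasiIso C).Localization

/-- The localization functor. -/
abbrev toDerived (C : Type u) [DGCategory C] : DGBimod C ⥤ Derived C := (quasiIso C).Q

/-- The functor between derived categories induced by a functor preserving quasi-isomorphisms. -/
def derivedMap {C D : Type u} [DGCategory C] [DGCategory D] (Φ : DGBimod C ⥤ DGBimod D)
    (hΦ : ∀ ⦃M N : DGBimod C⦄ (α : M ⟶ N), quasiIso C α → quasiIso D (Φ.map α)) :
    Derived C ⥤ Derived D :=
  Localization.Construction.lift (Φ ⋙ toDerived D)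
    (fun _ _ α hα => (quasiIso D).Q_inverts _ (hΦ α hα))

/-- The diagonal bimodule `C(X, Y)`, which represents the identity functor. -/
@[simps]
def diag (C : Type u) [DGCategory C] : DGBimod C where
  obj := hom
  lact h := comp h
  ract h := comp h
  one_lact := one_comp
  ract_one := comp_one
  lact_comp := assoc
  lact_ract := assoc
  ract_comp := assoc
  lact_leibniz := leibniz
  ract_leibniz := leibniz

/-- The dual complex: `(K^∨)^i = (K^{-i})^∨` with `(dξ)(x) = -(-1)^{|ξ|} ξ(dx)`. -/
def dualCx (K : Cx.{u}) : Cx.{u} where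
  X i := ModuleCat.of ℂ (Module.Dual ℂ (K.X (-i)))
  d i j := ModuleCat.ofHom ((i + 1).negOnePow • (K.d (-j) (-i)).hom.dualMap)
  shape i j h := by
    have : K.d (-j) (-i) = 0 := K.shape _ _ (by
      simp only [ComplexShape.up_Rel] at h ⊢; omega)
    apply ModuleCat.hom_ext
    refine LinearMap.ext fun (ξ : Module.Dual ℂ (K.X (-i))) => LinearMap.ext fun x => ?_
    change (i + 1).negOnePow • ξ ((K.d (-j) (-i)).hom x) = 0
    simp [this]
  d_comp_d' i j k _ _ := by
    apply ModuleCat.hom_ext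
    refine LinearMap.ext fun (ξ : Module.Dual ℂ (K.X (-i))) => LinearMap.ext fun x => ?_
    have : (K.d (-j) (-i)).hom ((K.d (-k) (-j)).hom x) = 0 := by
      rw [← ModuleCat.comp_apply]; simp
    change (j + 1).negOnePow • ((i + 1).negOnePow •
      ξ ((K.d (-j) (-i)).hom ((K.d (-k) (-j)).hom x))) = 0
    simp [this]

/-- The dual of a chain map. -/
def dualCxMap {K L : Cx.{u}} (α : K ⟶ L) : dualCx L ⟶ dualCx K where
  f i := ModuleCat.ofHom ((α.f (-i)).hom.dualMap)
  comm' i j _ := by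
    ext (ξ : Module.Dual ℂ (L.X (-i)))
    refine LinearMap.ext fun x => ?_
    have : (L.d (-j) (-i)).hom ((α.f (-j)).hom x) = (α.f (-i)).hom ((K.d (-j) (-i)).hom x) := by
      rw [← ModuleCat.comp_apply, ← ModuleCat.comp_apply, α.comm]
    change (i + 1).negOnePow • ξ ((α.f (-i)).hom ((K.d (-j) (-i)).hom x)) =
      (i + 1).negOnePow • ξ ((L.d (-j) (-i)).hom ((α.f (-j)).hom x))
    rw [this]

/-- The left action `(g ξ)(x) = (-1)^{|g|} ξ(x ∘ g)` on `C(Y, X)^∨`. -/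
def dualLact {C : Type u} [DGCategory C] {X Y Z : C} {i j k : ℤ} (h : i + j = k) :
    (hom Y Z).X i →ₗ[ℂ] Module.Dual ℂ ((hom Y X).X (-j)) →ₗ[ℂ] Module.Dual ℂ ((hom Z X).X (-k)) :=
  LinearMap.mk₂ ℂ (fun g ξ => i.negOnePow • ξ ∘ₗ (comp (show -k + i = -j by omega)).flip g)
    (by intros; ext; simp) (by intros; ext; simp [-smul_eq_mul, smul_comm (N := ℂ)])
    (by intros; ext; simp) (by intros; ext; simp [-smul_eq_mul, smul_comm (N := ℂ)])

/-- The right action `(ξ f)(x) = ξ(f ∘ x)` on `C(Y, X)^∨`. -/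
def dualRact {C : Type u} [DGCategory C] {X Y Z : C} {i j k : ℤ} (h : i + j = k) :
    Module.Dual ℂ ((hom Z Y).X (-i)) →ₗ[ℂ] (hom X Y).X j →ₗ[ℂ] Module.Dual ℂ ((hom Z X).X (-k)) :=
  LinearMap.mk₂ ℂ (fun ξ f => ξ ∘ₗ comp (show j + -k = -i by omega) f)
    (by intros; ext; simp) (by intros; ext; simp) (by intros; ext; simp)
    (by intros; ext; simp)

theorem dualLact_leibniz {C : Type u} [DGCategory C] {X Y Z : C} {i j k i' j' k' : ℤ}
    (h : i + j = k) (h₁ : i' + j = k') (h₂ : i + j' = k') (hi : i + 1 = i') (hj : j + 1 = j')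
    (g : (hom Y Z).X i) (ξ : Module.Dual ℂ ((hom Y X).X (-j))) (x : (hom Z X).X (-k')) :
    (k + 1).negOnePow • dualLact h g ξ (((hom Z X).d (-k') (-k)).hom x) =
      dualLact h₁ (((hom Y Z).d i i').hom g) ξ x +
        i.negOnePow • dualLact h₂ g
          ((j + 1).negOnePow • ξ ∘ₗ ((hom Y X).d (-j') (-j)).hom) x := by
  have hL := leibniz (show -k' + i = -j' by omega) (show -k + i = -j by omega)
    (show -k' + i' = -j by omega) (by omega) hi x g
  change (k + 1).negOnePow • i.negOnePow • ξ (comp _ _ g) =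
    i'.negOnePow • ξ (comp _ x _) + i.negOnePow • i.negOnePow • (j + 1).negOnePow •
      ξ (((hom Y X).d (-j') (-j)).hom (comp _ x g))
  rw [hL, map_add, Units.smul_def (-k').negOnePow, map_zsmul, ← Units.smul_def]
  subst h hi hj
  obtain rfl : i + (j + 1) = k' := h₂
  rcases Int.even_or_odd i with hi | hi <;> rcases Int.even_or_odd j with hj | hj <;>
    simp [Int.negOnePow_add, Int.negOnePow_even _, Int.negOnePow_odd _, hi, hj]

theorem dualRact_leibniz {C : Type u} [DGCategory C] {X Y Z : C} {i j k i' j' k' : ℤ}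
    (h : i + j = k) (h₁ : i' + j = k') (h₂ : i + j' = k') (hi : i + 1 = i') (hj : j + 1 = j')
    (ξ : Module.Dual ℂ ((hom Z Y).X (-i))) (f : (hom X Y).X j) (x : (hom Z X).X (-k')) :
    (k + 1).negOnePow • dualRact h ξ f (((hom Z X).d (-k') (-k)).hom x) =
      dualRact h₁ ((i + 1).negOnePow • ξ ∘ₗ ((hom Z Y).d (-i') (-i)).hom) f x +
        i.negOnePow • dualRact h₂ ξ (((hom X Y).d j j').hom f) x := by
  have hL := leibniz (show j + -k' = -i' by omega) (show j' + -k' = -i by omega)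
    (show j + -k = -i by omega) hj (by omega) f x
  change (k + 1).negOnePow • ξ (comp _ f _) = (i + 1).negOnePow •
      ξ (((hom Z Y).d (-i') (-i)).hom (comp _ f x)) + i.negOnePow • ξ (comp _ _ x)
  rw [hL, map_add, Units.smul_def j.negOnePow, map_zsmul, ← Units.smul_def]
  subst h hi hj
  obtain rfl : i + (j + 1) = k' := h₂
  rcases Int.even_or_odd i with hi | hi <;> rcases Int.even_or_odd j with hj | hj <;>
    simp [Int.negOnePow_add, Int.negOnePow_even _, Int.negOnePow_odd _, hi, hj]

/-- The Serre bimodule `(X, Y) ↦ C(Y, X)^∨`. -/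
def codiag (C : Type u) [DGCategory C] : DGBimod C where
  obj X Y := dualCx (hom Y X)
  lact h := dualLact h
  ract h := dualRact h
  one_lact {X Y i} (ξ : Module.Dual ℂ ((hom Y X).X (-i))) := by
    refine LinearMap.ext fun x => ?_
    change (0 : ℤ).negOnePow • ξ (comp _ x (one Y)) = ξ x
    rw [comp_one, Int.negOnePow_zero, one_smul]
  ract_one {X Y i} (ξ : Module.Dual ℂ ((hom Y X).X (-i))) := by
    refine LinearMap.ext fun x => ?_
    change ξ (comp _ (one X) x) = ξ x
    rw [one_comp]
  lact_comp {X Y Z T a b c ab bc abc} h₁ h₂ h₃ h₄ h g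
      (ξ : Module.Dual ℂ ((hom Y X).X (-c))) := by
    refine LinearMap.ext fun x => ?_
    change ab.negOnePow • ξ (comp _ x (comp _ h g)) =
      a.negOnePow • b.negOnePow • ξ (comp _ (comp _ x h) g)
    rw [smul_smul, ← Int.negOnePow_add, h₁, assoc]
  lact_ract {X Y Z T a b c ab bc abc} h₁ h₂ h₃ h₄ g
      (ξ : Module.Dual ℂ ((hom Z Y).X (-b))) f := by
    refine LinearMap.ext fun x => ?_
    change a.negOnePow • ξ (comp _ (comp _ f x) g) = a.negOnePow • ξ (comp _ f (comp _ x g))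
    rw [assoc]
  ract_comp {X Y Z T a b c ab bc abc} h₁ h₂ h₃ h₄
      (ξ : Module.Dual ℂ ((hom T Z).X (-a))) g f := by
    refine LinearMap.ext fun x => ?_
    change ξ (comp _ g (comp _ f x)) = ξ (comp _ (comp _ g f) x)
    rw [assoc]
  lact_leibniz h h₁ h₂ hi hj g ξ :=
    LinearMap.ext fun x => dualLact_leibniz h h₁ h₂ hi hj g ξ x
  ract_leibniz h h₁ h₂ hi hj ξ f :=
    LinearMap.ext fun x => dualRact_leibniz h h₁ h₂ hi hj ξ f x

/-- The shift `M[k]` of bimodules: `M[k](X, Y) = M(X, Y)[k]`, where `g` acts on the left with the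
additional sign `(-1)^{k|g|}`. -/
def shiftObj {C : Type u} [DGCategory C] (k : ℤ) (M : DGBimod C) : DGBimod C where
  obj := fun X Y => (CochainComplex.shiftFunctor _ k).obj (M.obj X Y)
  lact := fun {X Y Z i j l} h => (k * i).negOnePow • M.lact (show i + (j + k) = l + k by omega)
  ract := fun {X Y Z i j l} h => M.ract (show (i + k) + j = l + k by omega)
  one_lact := fun {X Y i} (m : (M.obj X Y).X (i + k)) => by
    change (k * 0).negOnePow • M.lact _ (one Y) m = m
    rw [mul_zero, Int.negOnePow_zero, one_smul]
    exact M.one_lact m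
  ract_one := fun {X Y i} m => M.ract_one m
  lact_comp := fun {X Y Z T a b c ab bc abc} h₁ h₂ h₃ h₄ h g
      (m : (M.obj X Y).X (c + k)) => by
    change (k * ab).negOnePow • M.lact _ (comp h₁ h g) m =
      (k * a).negOnePow • M.lact _ h ((k * b).negOnePow • M.lact _ g m)
    rw [Units.smul_def (k * b).negOnePow, map_zsmul, ← Units.smul_def, smul_smul,
      ← Int.negOnePow_add, ← mul_add, h₁,
      M.lact_comp h₁ (show b + (c + k) = bc + k by omega) _ (by omega)]
  lact_ract := fun {X Y Z T a b c ab bc abc} h₁ h₂ h₃ h₄ g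
      (m : (M.obj Y Z).X (b + k)) f => by
    change M.ract _ ((k * a).negOnePow • M.lact _ g m) f =
      (k * a).negOnePow • M.lact _ g (M.ract _ m f)
    rw [Units.smul_def, map_zsmul, LinearMap.smul_apply, ← Units.smul_def,
      M.lact_ract _ (show b + k + c = bc + k by omega) _ (by omega)]
  ract_comp := fun {X Y Z T a b c ab bc abc} h₁ h₂ h₃ h₄ m g f =>
    M.ract_comp _ h₂ _ _ m g f
  lact_leibniz := fun {X Y Z i j l i' j' l'} h h₁ h₂ hi hj g
      (m : (M.obj X Y).X (j + k)) => by
    change k.negOnePow • ((M.obj X Z).d (l + k) (l' + k)).hom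
        ((k * i).negOnePow • M.lact _ g m) =
      (k * i').negOnePow • M.lact _ _ m + i.negOnePow • (k * i).negOnePow • M.lact _ g
        (k.negOnePow • ((M.obj X Y).d (j + k) (j' + k)).hom m)
    rw [Units.smul_def (k * i).negOnePow (M.lact _ g m), map_zsmul, ← Units.smul_def,
      Units.smul_def k.negOnePow (((M.obj X Y).d (j + k) (j' + k)).hom m), map_zsmul,
      ← Units.smul_def,
      M.lact_leibniz _ (show i' + (j + k) = l' + k by omega)
        (show i + (j' + k) = l' + k by omega) hi (by omega)]
    subst hi
    simp only [smul_add, smul_smul, ← Int.negOnePow_add]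
    rw [show k + k * i = k * (i + 1) by ring, show k + (k * i + i) = i + (k * i + k) by ring]
    rfl
  ract_leibniz := fun {X Y Z i j l i' j' l'} h h₁ h₂ hi hj
      (m : (M.obj Y Z).X (i + k)) f => by
    change k.negOnePow • ((M.obj X Z).d (l + k) (l' + k)).hom (M.ract _ m f) =
      M.ract _ (k.negOnePow • ((M.obj Y Z).d (i + k) (i' + k)).hom m) f +
        i.negOnePow • M.ract _ m _
    rw [Units.smul_def k.negOnePow (((M.obj Y Z).d (i + k) (i' + k)).hom m), map_zsmul,
      LinearMap.smul_apply, ← Units.smul_def,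
      M.ract_leibniz _ (show i' + k + j = l' + k by omega)
        (show i + k + j' = l' + k by omega) (by omega) hj]
    simp only [smul_add, smul_smul, ← Int.negOnePow_add]
    congr 2
    rw [show k + (i + k) = i + 2 * k by ring, Int.negOnePow_add, Int.negOnePow_two_mul,
      mul_one]

/-- The shift functor `M ↦ M[k]`. -/
def shift {C : Type u} [DGCategory C] (k : ℤ) : DGBimod C ⥤ DGBimod C where
  obj M := shiftObj k M
  map {M N} α :=
    { app := fun X Y => (CochainComplex.shiftFunctor _ k).map (α.app X Y)
      map_lact := fun {X Y Z i j l} h g (m : (M.obj X Y).X (j + k)) => by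
        change ((α.app X Z).f (l + k)).hom ((k * i).negOnePow • M.lact _ g m) =
          (k * i).negOnePow • N.lact _ g (((α.app X Y).f (j + k)).hom m)
        rw [Units.smul_def, map_zsmul, α.map_lact _ g m, ← Units.smul_def]
      map_ract := fun {X Y Z i j l} h (m : (M.obj Y Z).X (i + k)) f =>
        α.map_ract (show i + k + j = l + k by omega) m f }
  map_id _ := rfl
  map_comp _ _ := rfl

theorem shift_quasiIso {C : Type u} [DGCategory C] (k : ℤ) ⦃M N : DGBimod C⦄ (α : M ⟶ N)
    (hα : quasiIso C α) : quasiIso C ((shift k).map α) := by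
  intro X Y
  have := hα X Y
  exact (CochainComplex.quasiIso_shift_iff (α.app X Y) k).2 this

theorem map_d {K L : Cx.{u}} (α : K ⟶ L) (i j : ℤ) (x : K.X i) :
    (α.f j).hom ((K.d i j).hom x) = (L.d i j).hom ((α.f i).hom x) := by
  rw [← ModuleCat.comp_apply, ← ModuleCat.comp_apply, α.comm]

/-- The pullback `(X, Y) ↦ M(F X, F Y)` of bimodules along a dg-functor `F`. -/
def pullback {C D : Type u} [DGCategory C] [DGCategory D] (F : DGFunctor D C) :
    DGBimod C ⥤ DGBimod D where
  obj M :=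
    { obj := fun X Y => M.obj (F.obj X) (F.obj Y)
      lact := fun {X Y Z i j k} h => (M.lact h).comp ((F.map Y Z).f i).hom
      ract := fun {X Y Z i j k} h => (M.ract h).compl₂ ((F.map X Y).f j).hom
      one_lact := fun m => by simp [F.map_one, M.one_lact]
      ract_one := fun m => by simp [F.map_one, M.ract_one]
      lact_comp := fun h₁ h₂ h₃ h₄ h g m => by simp [F.map_comp, M.lact_comp h₁ h₂ h₃ h₄]
      lact_ract := fun h₁ h₂ h₃ h₄ g m f => by simp [M.lact_ract h₁ h₂ h₃ h₄]
      ract_comp := fun h₁ h₂ h₃ h₄ m g f => by simp [F.map_comp, M.ract_comp h₁ h₂ h₃ h₄]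
      lact_leibniz := fun h h₁ h₂ hi hj g m => by
        simp [M.lact_leibniz h h₁ h₂ hi hj, map_d]
      ract_leibniz := fun h h₁ h₂ hi hj m f => by
        simp [M.ract_leibniz h h₁ h₂ hi hj, map_d] }
  map α :=
    { app := fun X Y => α.app (F.obj X) (F.obj Y)
      map_lact := fun h _ m => α.map_lact h _ m
      map_ract := fun h m _ => α.map_ract h m _ }
  map_id _ := rfl
  map_comp _ _ := rfl

/-- The map `C(X, Y) → D(F X, F Y)`. -/
def diagMap {C D : Type u} [DGCategory C] [DGCategory D] (F : DGFunctor D C) :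
    diag D ⟶ (pullback F).obj (diag C) where
  app X Y := F.map X Y
  map_lact h g f := F.map_comp h g f
  map_ract h g f := F.map_comp h g f

/-- The dual map `D(F Y, F X)^∨ → C(Y, X)^∨`. -/
def codiagMap {C D : Type u} [DGCategory C] [DGCategory D] (F : DGFunctor D C) :
    (pullback F).obj (codiag C) ⟶ codiag D where
  app X Y := dualCxMap (F.map Y X)
  map_lact {X Y Z i j k} h g (ξ : Module.Dual ℂ ((hom (F.obj Y) (F.obj X)).X (-j))) := by
    refine LinearMap.ext fun x => ?_
    change i.negOnePow • ξ (comp _ (((F.map Z X).f (-k)).hom x) (((F.map Y Z).f i).hom g)) =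
      i.negOnePow • ξ (((F.map Y X).f (-j)).hom (comp _ x g))
    rw [F.map_comp]
  map_ract {X Y Z i j k} h (ξ : Module.Dual ℂ ((hom (F.obj Z) (F.obj Y)).X (-i))) f := by
    refine LinearMap.ext fun x => ?_
    change ξ (comp _ (((F.map X Y).f j).hom f) (((F.map Z X).f (-k)).hom x)) =
      ξ (((F.map Z Y).f (-i)).hom (comp _ f x))
    rw [F.map_comp]

/-- The functor `M ↦ M[k]` on the derived category. -/
def derivedShift (C : Type u) [DGCategory C] (k : ℤ) : Derived C ⥤ Derived C :=
  derivedMap (shift k) (shift_quasiIso k)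

/-- The functor `M ↦ M(F -, F -)` between derived categories. -/
def derivedPullback {C D : Type u} [DGCategory C] [DGCategory D] (F : DGFunctor D C) :
    Derived C ⥤ Derived D :=
  derivedMap (pullback F) (fun _ _ _ h X Y => h (F.obj X) (F.obj Y))

/-- For closed `u ∈ M(Z, Y)^0`, the map `C(X, Z) → M(X, Y)`, `f ↦ u f`. -/
def evalRight {C : Type u} [DGCategory C] (M : DGBimod C) {Z Y : C} (u : (M.obj Z Y).X 0)
    (hu : ((M.obj Z Y).d 0 1).hom u = 0) (X : C) : hom X Z ⟶ M.obj X Y where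
  f i := ModuleCat.ofHom (M.ract (zero_add i) u)
  comm' i j hij := by
    apply ModuleCat.hom_ext
    refine LinearMap.ext fun f => ?_
    change ((M.obj X Y).d i j).hom (M.ract _ u f) = M.ract _ u (((hom X Z).d i j).hom f)
    rw [M.ract_leibniz (zero_add i) (show 1 + i = j by rw [add_comm]; exact hij) (zero_add j)
      (zero_add 1) hij, hu]
    simp

/-- For closed `u ∈ M(Z, Y)^0`, the map `C(Y, X) → M(Z, X)`, `f ↦ f u`. -/
def evalLeft {C : Type u} [DGCategory C] (M : DGBimod C) {Z Y : C} (u : (M.obj Z Y).X 0)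
    (hu : ((M.obj Z Y).d 0 1).hom u = 0) (X : C) : hom Y X ⟶ M.obj Z X where
  f i := ModuleCat.ofHom ((M.lact (add_zero i)).flip u)
  comm' i j hij := by
    apply ModuleCat.hom_ext
    refine LinearMap.ext fun f => ?_
    change ((M.obj Z X).d i j).hom (M.lact _ f u) = M.lact _ (((hom Y X).d i j).hom f) u
    rw [M.lact_leibniz (add_zero i) (add_zero j) hij hij (zero_add 1), hu]
    simp

/-- `u ∈ M(Z, Y)^0` is biuniversal if it is closed and induces quasi-isomorphisms
`C(-, Z) → M(-, Y)` and `C(Y, -) → M(Z, -)`. -/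
def IsBiuniversal {C : Type u} [DGCategory C] (M : DGBimod C) {Z Y : C} (u : (M.obj Z Y).X 0) :
    Prop :=
  ∃ hu : ((M.obj Z Y).d 0 1).hom u = 0,
    (∀ X, QuasiIso (evalRight M u hu X)) ∧ ∀ X, QuasiIso (evalLeft M u hu X)

end DGBimod

open DGBimod

/-- A Serre functor on `C`. The functor `S` is a quasi-functor, given by the bimodule
`(X, Y) ↦ C(X, S Y)`; it is an autoequivalence, and it comes with a binatural isomorphism
`C(X, S Y) ≅ C(Y, X)^∨` in the derived category of bimodules. The spaces `H^i C(X, Y)` are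
finite-dimensional. -/
structure SerreFunctor (C : Type u) [DGCategory C] where
  finite (X Y : C) (i : ℤ) : Module.Finite ℂ ((hom X Y).homology i)
  bimod : DGBimod C
  repr (Y : C) : ∃ (Z : C) (u : (bimod.obj Z Y).X 0), IsBiuniversal bimod u
  essSurj (Z : C) : ∃ (Y : C) (u : (bimod.obj Z Y).X 0), IsBiuniversal bimod u
  duality : (toDerived C).obj bimod ≅ (toDerived C).obj (codiag C)

/-- `HH^k(C, M)`: morphisms `id → M[k]` in the derived category of bimodules. -/
abbrev HH {C : Type u} [DGCategory C] (M : DGBimod C) (k : ℤ) :=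
  (toDerived C).obj (diag C) ⟶ (toDerived C).obj ((shift k).obj M)

/-- The map `HH^k(C, S_C) → HH^k(D, S_D)` induced by a dg-functor `F : D → C`. It sends
`a : id_C → S_C[k]` to the composite of bimodule maps
`D(X, Y) → C(F X, F Y) → C(F X, S_C F Y)[k] ≅ C(F Y, F X)^∨[k] → D(Y, X)^∨[k] ≅ D(X, S_D Y)[k]`,
whose second arrow is `a`, whose isomorphisms are Serre duality, and whose other arrows are
given by `F` and its dual.

If `F` is an autoequivalence of `C`, then `C(F X, F Y) = C(X, F⁻¹ F Y)` and
`C(F X, S F Y) = C(X, F⁻¹ S F Y)`, so this is the conjugate `F⁻¹ a F : id → F⁻¹ S F[k] ≅ S[k]`,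
where `F⁻¹ S F ≅ S` is the canonical isomorphism provided by Serre duality. -/
def pullHH {C D : Type u} [DGCategory C] [DGCategory D] (F : DGFunctor D C)
    (S : SerreFunctor C) (T : SerreFunctor D) {k : ℤ} (a : HH S.bimod k) : HH T.bimod k :=
  (toDerived D).map (diagMap F) ≫
    (derivedPullback F).map (a ≫ (derivedShift C k).map S.duality.hom) ≫
      (derivedShift D k).map ((toDerived D).map (codiagMap F) ≫ T.duality.inv)

/-- A Calabi--Yau dg-category of dimension `n`: a pre-triangulated dg-category with a Serre functor
`S` and an isomorphism `id ≅ S[-n]`. -/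
def IsCalabiYau (C : Type u) [DGCategory C] (n : ℤ) : Prop :=
  IsPretriangulated C ∧ ∃ (S : SerreFunctor C) (a : HH S.bimod (-n)), IsIso a

/-! ### Group actions and equivariant categories -/

/-- An action of a group `G` on a dg-category: dg-autoequivalences `ρ_g` and dg-natural isomorphisms
`θ_{g,h} : ρ_g ρ_h → ρ_{gh}`, satisfying the associativity constraint. The argument `e : g * h = k`
of `θ` avoids transports along equalities of objects. -/
structure DGAction (G : Type u) [Group G] (C : Type u) [DGCategory C] where
  F : G → DGFunctor C C
  isEquiv (g : G) : (F g).IsEquiv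
  θ {g h k : G} (e : g * h = k) (X : C) : (hom ((F g).obj ((F h).obj X)) ((F k).obj X)).X 0
  isDGIso_θ {g h k : G} (e : g * h = k) (X : C) : IsDGIso (θ e X)
  naturality {g h k : G} (e : g * h = k) {X Y : C} {i : ℤ} (f : (hom X Y).X i) :
    comp (zero_add i) (θ e Y) ((((F g).map _ _).f i).hom ((((F h).map X Y).f i).hom f)) =
      comp (add_zero i) ((((F k).map X Y).f i).hom f) (θ e X)
  assoc {g h k gh hk ghk : G} (e₁ : g * h = gh) (e₂ : h * k = hk) (e₃ : gh * k = ghk)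
    (e₄ : g * hk = ghk) (X : C) :
    comp (add_zero 0) (θ e₃ X) (θ e₁ ((F k).obj X)) =
      comp (add_zero 0) (θ e₄ X) ((((F g).map _ _).f 0).hom (θ e₂ X))

/-- The conjugation action `a ↦ ρ_g a ρ_g⁻¹` of `G` on `HH^k(C, S)`. -/
def DGAction.actHH {G : Type u} [Group G] {C : Type u} [DGCategory C] (ρ : DGAction G C)
    (S : SerreFunctor C) (g : G) {k : ℤ} (a : HH S.bimod k) : HH S.bimod k :=
  pullHH (ρ.F g⁻¹) S S a

/-- Objects of the equivariant category `C_G`: objects with a `G`-linearization. -/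
structure Equivariant {G : Type u} [Group G] {C : Type u} [DGCategory C] (ρ : DGAction G C) where
  obj : C
  φ (g : G) : (hom obj ((ρ.F g).obj obj)).X 0
  isDGIso_φ (g : G) : IsDGIso (φ g)
  cocycle {g h k : G} (e : g * h = k) :
    φ k = comp (add_zero 0) (ρ.θ e obj)
      (comp (add_zero 0) ((((ρ.F g).map _ _).f 0).hom (φ h)) (φ g))

namespace Equivariant

section

variable {G : Type u} [Group G] {C : Type u} [DGCategory C] {ρ : DGAction G C}

/-- The `G`-invariant morphisms `f` of degree `i`: those with `φ'_g ∘ f = ρ_g(f) ∘ φ_g`. -/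
def invariants (A B : Equivariant ρ) (i : ℤ) : Submodule ℂ ((hom A.obj B.obj).X i) where
  carrier := {f | ∀ g : G, comp (zero_add i) (B.φ g) f =
    comp (add_zero i) ((((ρ.F g).map _ _).f i).hom f) (A.φ g)}
  add_mem' ha hb g := by simp [ha g, hb g]
  zero_mem' g := by simp
  smul_mem' c f hf g := by simp [hf g]

theorem d_mem (A B : Equivariant ρ) (i j : ℤ) (f : (hom A.obj B.obj).X i)
    (hf : f ∈ invariants A B i) : ((hom A.obj B.obj).d i j).hom f ∈ invariants A B j := by
  by_cases h : i + 1 = j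
  · intro g
    have h₁ := leibniz (zero_add i) (show 1 + i = j by omega) (zero_add j) (zero_add 1) h (B.φ g) f
    have h₂ := leibniz (add_zero i) (add_zero j) h h (zero_add 1)
      ((((ρ.F g).map _ _).f i).hom f) (A.φ g)
    rw [(B.isDGIso_φ g).1, hf g] at h₁
    rw [(A.isDGIso_φ g).1] at h₂
    have h₃ : ((hom _ _).d i j).hom ((((ρ.F g).map A.obj B.obj).f i).hom f) =
        (((ρ.F g).map A.obj B.obj).f j).hom (((hom _ _).d i j).hom f) := by
      rw [← ModuleCat.comp_apply, ← ModuleCat.comp_apply, HomologicalComplex.Hom.comm]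
    rw [h₃] at h₂
    rw [h₂] at h₁
    simpa using h₁.symm
  · rw [(hom A.obj B.obj).shape i j h]
    exact Submodule.zero_mem _

/-- The complex of `G`-invariant morphisms. -/
def homCx (A B : Equivariant ρ) : Cx.{u} where
  X i := ModuleCat.of ℂ (invariants A B i)
  d i j := ModuleCat.ofHom (((hom A.obj B.obj).d i j).hom.restrict (d_mem A B i j))
  shape i j h := by
    apply ModuleCat.hom_ext
    refine LinearMap.ext fun f => Subtype.ext ?_
    change ((hom A.obj B.obj).d i j).hom f.1 = 0
    rw [(hom A.obj B.obj).shape i j h]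
    rfl
  d_comp_d' i j k _ _ := by
    apply ModuleCat.hom_ext
    refine LinearMap.ext fun f => Subtype.ext ?_
    change ((hom A.obj B.obj).d j k).hom (((hom A.obj B.obj).d i j).hom f.1) = 0
    rw [← ModuleCat.comp_apply]
    simp

theorem one_mem (A : Equivariant ρ) : one A.obj ∈ invariants A A 0 := fun g => by
  rw [comp_one, (ρ.F g).map_one, one_comp]

theorem comp_mem {A B D : Equivariant ρ} {i j k : ℤ} (h : i + j = k)
    (g : (hom B.obj D.obj).X i) (f : (hom A.obj B.obj).X j)
    (hg : g ∈ invariants B D i) (hf : f ∈ invariants A B j) :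
    comp h g f ∈ invariants A D k := fun x => by
  rw [← DGCategory.assoc (zero_add i) h h (zero_add k), hg x,
    DGCategory.assoc (add_zero i) (zero_add j) h h, hf x, (ρ.F x).map_comp,
    DGCategory.assoc h (add_zero j) (add_zero k) h]

/-- Composition of `G`-invariant morphisms. -/
def compInv {A B D : Equivariant ρ} {i j k : ℤ} (h : i + j = k) :
    invariants B D i →ₗ[ℂ] invariants A B j →ₗ[ℂ] invariants A D k :=
  LinearMap.mk₂ ℂ (fun g f => ⟨comp h g.1 f.1, comp_mem h g.1 f.1 g.2 f.2⟩)
    (by intros; apply Subtype.ext; simp) (by intros; apply Subtype.ext; simp)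
    (by intros; apply Subtype.ext; simp) (by intros; apply Subtype.ext; simp)

/-- The equivariant dg-category `C_G`. -/
instance : DGCategory (Equivariant ρ) where
  hom := homCx
  one A := (⟨one A.obj, one_mem A⟩ : invariants A A 0)
  comp h := compInv h
  one_comp f := Subtype.ext (one_comp f.1)
  comp_one f := Subtype.ext (comp_one f.1)
  assoc h₁ h₂ h₃ h₄ h g f := Subtype.ext (DGCategory.assoc h₁ h₂ h₃ h₄ h.1 g.1 f.1)
  d_one A := Subtype.ext (d_one A.obj)
  leibniz {A B D i j k i' j' k'} h h₁ h₂ hi hj g f := by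
    apply Subtype.ext
    refine (leibniz h h₁ h₂ hi hj g.1 f.1).trans ?_
    rw [Units.smul_def, Units.smul_def]
    rfl

/-- The forgetful functor `p : C_G → C`. -/
def forget (ρ : DGAction G C) : DGFunctor (Equivariant ρ) C where
  obj A := A.obj
  map A B := { f := fun i => ModuleCat.ofHom (invariants A B i).subtype, comm' := fun _ _ _ => rfl }
  map_one _ := rfl
  map_comp _ _ _ := rfl

/-- The object `χ · (E, φ) = (E, χ φ)`. -/
def twist (χ : G →* ℂˣ) (A : Equivariant ρ) : Equivariant ρ where
  obj := A.obj
  φ g := (χ g : ℂ) • A.φ g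
  isDGIso_φ g := by
    obtain ⟨h₁, ψ, h₂, h₃⟩ := A.isDGIso_φ g
    refine ⟨by rw [map_smul, h₁, smul_zero], (χ g : ℂ)⁻¹ • ψ, ?_, ?_⟩
    · simp [h₂, smul_smul]
    · simp [h₃, smul_smul]
  cocycle {g h k} e := by
    subst e
    simp [A.cocycle rfl, smul_smul]

theorem mem_twist_iff (χ : G →* ℂˣ) {A B : Equivariant ρ} {i : ℤ} (f : (hom A.obj B.obj).X i) :
    f ∈ invariants (twist χ A) (twist χ B) i ↔ f ∈ invariants A B i := by
  refine forall_congr' fun g => ?_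
  change comp _ ((χ g : ℂ) • B.φ g) f = comp _ _ ((χ g : ℂ) • A.φ g) ↔ _
  rw [map_smul, map_smul, LinearMap.smul_apply]
  exact (smul_right_injective _ (χ g).ne_zero).eq_iff

/-- The dg-functor `(E, φ) ↦ (E, χ φ)`, which is the identity on morphisms. -/
def twistFunctor (ρ : DGAction G C) (χ : G →* ℂˣ) :
    DGFunctor (Equivariant ρ) (Equivariant ρ) where
  obj := twist χ
  map A B :=
    { f := fun _ => ModuleCat.ofHom
        (Submodule.inclusion fun f hf => (mem_twist_iff χ (A := A) (B := B) f).2 hf)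
      comm' := fun _ _ _ => rfl }
  map_one _ := rfl
  map_comp _ _ _ := rfl

theorem one_mem_mk {E : C} {φ φ' : ∀ g, (hom E ((ρ.F g).obj E)).X 0} {h h' c c'}
    (e : ∀ g, φ g = φ' g) :
    one E ∈ invariants (⟨E, φ, h, c⟩ : Equivariant ρ) ⟨E, φ', h', c'⟩ 0 := fun g => by
  rw [comp_one, (ρ.F g).map_one, one_comp]
  exact (e g).symm

/-- The identity of `E` as an isomorphism between equivariant objects with equal linearizations. -/
theorem isDGIso_one {E : C} {φ φ' : ∀ g, (hom E ((ρ.F g).obj E)).X 0} {h h' c c'}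
    (e : ∀ g, φ g = φ' g) :
    IsDGIso (X := (⟨E, φ, h, c⟩ : Equivariant ρ)) (Y := ⟨E, φ', h', c'⟩)
      (⟨one E, one_mem_mk e⟩ : invariants (⟨E, φ, h, c⟩ : Equivariant ρ) ⟨E, φ', h', c'⟩ 0) :=
  ⟨Subtype.ext (d_one E),
    (⟨one E, one_mem_mk fun g => (e g).symm⟩ :
      invariants (⟨E, φ', h', c'⟩ : Equivariant ρ) ⟨E, φ, h, c⟩ 0),
    Subtype.ext (one_comp (one E)), Subtype.ext (one_comp (one E))⟩

theorem smul_smul_φ {χ ψ ω : G →* ℂˣ} (e : χ * ψ = ω) (A : Equivariant ρ) (g : G) :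
    (χ g : ℂ) • (ψ g : ℂ) • A.φ g = (ω g : ℂ) • A.φ g := by
  subst e
  simp [smul_smul]

/-- The action of the group of characters `G^∨` on `C_G`: `χ` acts by `(E, φ) ↦ (E, χ φ)`, and the
isomorphisms `χ · (ψ · (E, φ)) → χψ · (E, φ)` are the identity of `E`. -/
def dualAction (ρ : DGAction G C) : DGAction (G →* ℂˣ) (Equivariant ρ) where
  F := twistFunctor ρ
  isEquiv χ :=
    { isIso_map := fun A B =>
        ⟨{ f := fun _ => ModuleCat.ofHom
              (Submodule.inclusion fun f hf => (mem_twist_iff χ (A := A) (B := B) f).1 hf)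
           comm' := fun _ _ _ => rfl }, rfl, rfl⟩
      essSurj := fun A => ⟨twist χ⁻¹ A, _, isDGIso_one (h := (twist χ (twist χ⁻¹ A)).isDGIso_φ)
        (h' := A.isDGIso_φ) (c := (twist χ (twist χ⁻¹ A)).cocycle) (c' := A.cocycle) fun g => by
          refine (smul_smul_φ (mul_inv_cancel χ) A g).trans ?_
          simp⟩ }
  θ {χ ψ ω} e A := (⟨one A.obj, one_mem_mk (h := (twist χ (twist ψ A)).isDGIso_φ)
    (h' := (twist ω A).isDGIso_φ) (c := (twist χ (twist ψ A)).cocycle) (c' := (twist ω A).cocycle)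
    (smul_smul_φ e A)⟩ : invariants (twist χ (twist ψ A)) (twist ω A) 0)
  isDGIso_θ e A := isDGIso_one (smul_smul_φ e A)
  naturality {_ _ _} _ {_ _ _} f := Subtype.ext ((one_comp f.1).trans (comp_one f.1).symm)
  assoc e₁ e₂ e₃ e₄ A := rfl

end

end Equivariant

end DG

end

/-! ### Functors and natural transformations between derived categories -/

noncomputable section

namespace DG

open DGCategory DGBimod

namespace DGBimod

/-! Serre duality turns a class `id → S[-n]` into a pairing `α : C(X, Y) → C(Y, X)^∨[-n]` in the
derived category of bimodules, which is an isomorphism if and only if the class is. In this form the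
Serre functor disappears: transport along a dg-functor `F` becomes `restrictPairing F`, the pullback
of `α` flanked by `F` and its dual, and invariance of `a` says that restriction along every `ρ_g`
fixes `α`.

Pull `α` back along `p : C_G → C` to an isomorphism `α'` of bimodules over `C_G`. On its source and
target `G` acts by genuine bimodule endomorphisms, namely conjugation by the linearizations and its
dual, and invariance of `α` makes `α'` equivariant (`pairing_comp_act`). Since `|G|` is invertible
in `ℂ`, averaging exhibits `C_G(A, B)` as a retract of `C(A, B)`, and dually. As `α'` commutes with
the averaging idempotents (`derived_average_comm`), it induces an isomorphism of the retracts, and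
this is the restriction of `α` along `p` (`isIso_restrictPairing_forget`). Averages of derived
morphisms are expressed through finite products, which the localization preserves, so an additive
structure on the derived category is not needed.

Zero objects, shifts and cones in `C` inherit linearizations (`isPretriangulated`), and homology
stays finite-dimensional on a retract (`finite_homology`). The isomorphism `C_G(A, B) ≅ C_G(B,
A)^∨[-n]` makes the shift `[n]` a Serre functor, hence `C_G` Calabi–Yau (`IsCalabiYau.of_iso`). For
any other Serre functor the induced class is this isomorphism followed by the inverse of duality. It
is fixed by `G^∨` because twisting by `χ` is invisible to `p`, that is, `p ∘ χ = p`
(`restrictPairing_twistFunctor`). -/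

theorem hom_ext {C : Type u} [DGCategory C] {M N : DGBimod C} {α β : M ⟶ N}
    (h : ∀ (X Y : C) (i : ℤ) (m : (M.obj X Y).X i),
      ((α.app X Y).f i).hom m = ((β.app X Y).f i).hom m) : α = β := by
  apply Hom.ext
  funext X Y
  ext i m
  exact h X Y i m

section Derived

variable {C D : Type u} [DGCategory C] [DGCategory D]

theorem derivedMap_map (Φ : DGBimod C ⥤ DGBimod D)
    (hΦ : ∀ ⦃M N : DGBimod C⦄ (α : M ⟶ N), quasiIso C α → quasiIso D (Φ.map α))
    {M N : DGBimod C} (α : M ⟶ N) :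
    (derivedMap Φ hΦ).map ((toDerived C).map α) = (toDerived D).map (Φ.map α) := by
  have := Functor.congr_hom (Localization.Construction.fac (W := quasiIso C) (Φ ⋙ toDerived D)
    (fun _ _ α hα => (quasiIso D).Q_inverts _ (hΦ α hα))) α
  simpa using! this

/-- The natural transformation between derived functors induced by one between functors that
preserve quasi-isomorphisms. -/
def derivedNatTrans {Φ Ψ : DGBimod C ⥤ DGBimod D}
    (hΦ : ∀ ⦃M N : DGBimod C⦄ (α : M ⟶ N), quasiIso C α → quasiIso D (Φ.map α))
    (hΨ : ∀ ⦃M N : DGBimod C⦄ (α : M ⟶ N), quasiIso C α → quasiIso D (Ψ.map α))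
    (τ : Φ ⟶ Ψ) : derivedMap Φ hΦ ⟶ derivedMap Ψ hΨ :=
  Localization.Construction.natTransExtension
    { app := fun M => (toDerived D).map (τ.app M)
      naturality := fun M N α => by
        have h : (toDerived D).map (Φ.map α) ≫ (toDerived D).map (τ.app N) =
            (toDerived D).map (τ.app M) ≫ (toDerived D).map (Ψ.map α) := by
          rw [← Functor.map_comp, ← Functor.map_comp, τ.naturality]
        exact (congrArg (· ≫ (toDerived D).map (τ.app N)) (derivedMap_map Φ hΦ α)).trans
          (h.trans (congrArg ((toDerived D).map (τ.app M) ≫ ·) (derivedMap_map Ψ hΨ α)).symm) }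

theorem derivedNatTrans_app {Φ Ψ : DGBimod C ⥤ DGBimod D}
    (hΦ : ∀ ⦃M N : DGBimod C⦄ (α : M ⟶ N), quasiIso C α → quasiIso D (Φ.map α))
    (hΨ : ∀ ⦃M N : DGBimod C⦄ (α : M ⟶ N), quasiIso C α → quasiIso D (Ψ.map α))
    (τ : Φ ⟶ Ψ) (M : DGBimod C) :
    (derivedNatTrans hΦ hΨ τ).app ((toDerived C).obj M) = (toDerived D).map (τ.app M) :=
  Localization.Construction.NatTransExtension.app_eq _ M

/-- Natural transformations between functors preserving quasi-isomorphisms are natural with respect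
to the morphisms of the derived category. -/
theorem derivedMap_naturality {Φ Ψ : DGBimod C ⥤ DGBimod D}
    (hΦ : ∀ ⦃M N : DGBimod C⦄ (α : M ⟶ N), quasiIso C α → quasiIso D (Φ.map α))
    (hΨ : ∀ ⦃M N : DGBimod C⦄ (α : M ⟶ N), quasiIso C α → quasiIso D (Ψ.map α))
    (τ : Φ ⟶ Ψ) {M N : DGBimod C} (α : (toDerived C).obj M ⟶ (toDerived C).obj N) :
    (derivedMap Φ hΦ).map α ≫ (toDerived D).map (τ.app N) =
      (toDerived D).map (τ.app M) ≫ (derivedMap Ψ hΨ).map α := by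
  have h := (derivedNatTrans hΦ hΨ τ).naturality α
  have hM := derivedNatTrans_app hΦ hΨ τ M
  have hN := derivedNatTrans_app hΦ hΨ τ N
  exact (congrArg ((derivedMap Φ hΦ).map α ≫ ·) hN).symm.trans
    (h.trans (congrArg (· ≫ (derivedMap Ψ hΨ).map α) hM))

/-- A functor out of the localization is determined, up to equality, by its composite with
`toDerived`. The same uniqueness gives `derivedMap_comp`. -/
theorem derivedMap_id {M N : DGBimod C} (α : (toDerived C).obj M ⟶ (toDerived C).obj N) :
    (derivedMap (𝟭 (DGBimod C)) (fun _ _ _ h => h)).map α = α := by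
  have h : derivedMap (𝟭 (DGBimod C)) (fun _ _ _ h => h) = 𝟭 _ :=
    Localization.Construction.uniq _ _ (Localization.Construction.fac _ _)
  exact (Functor.congr_hom h α).trans ((Category.id_comp _).trans (Category.comp_id _))

theorem derivedMap_comp {E : Type u} [DGCategory E] (Φ : DGBimod C ⥤ DGBimod D)
    (hΦ : ∀ ⦃M N : DGBimod C⦄ (α : M ⟶ N), quasiIso C α → quasiIso D (Φ.map α))
    (Ψ : DGBimod D ⥤ DGBimod E)
    (hΨ : ∀ ⦃M N : DGBimod D⦄ (α : M ⟶ N), quasiIso D α → quasiIso E (Ψ.map α))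
    {M N : DGBimod C} (α : (toDerived C).obj M ⟶ (toDerived C).obj N) :
    (derivedMap Ψ hΨ).map ((derivedMap Φ hΦ).map α) =
      (derivedMap (Φ ⋙ Ψ) (fun _ _ _ h => hΨ _ (hΦ _ h))).map α := by
  have h : derivedMap Φ hΦ ⋙ derivedMap Ψ hΨ =
      derivedMap (Φ ⋙ Ψ) (fun _ _ _ h => hΨ _ (hΦ _ h)) := by
    refine Localization.Construction.uniq _ _ ?_
    have h₁ : toDerived C ⋙ derivedMap Φ hΦ = Φ ⋙ toDerived D :=
      Localization.Construction.fac _ _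
    have h₂ : toDerived D ⋙ derivedMap Ψ hΨ = Ψ ⋙ toDerived E :=
      Localization.Construction.fac _ _
    have h₃ : toDerived C ⋙ derivedMap (Φ ⋙ Ψ) (fun _ _ _ h => hΨ _ (hΦ _ h)) =
      (Φ ⋙ Ψ) ⋙ toDerived E := Localization.Construction.fac _ _
    exact ((congrArg (· ⋙ derivedMap Ψ hΨ) h₁).trans (congrArg (Φ ⋙ ·) h₂)).trans h₃.symm
  exact (Functor.congr_hom h α).trans ((Category.id_comp _).trans (Category.comp_id _))

end Derived

end DGBimod

end DG

/-! ### Finite products and averages in the derived category of bimodules -/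

namespace DG

open DGCategory DGBimod Limits

/-- The product of a family of complexes. -/
def piCx {J : Type} (K : J → Cx.{u}) : Cx.{u} where
  X i := ModuleCat.of ℂ (∀ j, (K j).X i)
  d i i' := ModuleCat.ofHom (LinearMap.pi fun j => ((K j).d i i').hom ∘ₗ LinearMap.proj j)
  shape i i' h := by
    apply ModuleCat.hom_ext
    refine LinearMap.ext fun x => funext fun j => ?_
    change ((K j).d i i').hom (x j) = 0
    rw [(K j).shape i i' h]
    rfl
  d_comp_d' i i' i'' _ _ := by
    apply ModuleCat.hom_ext
    refine LinearMap.ext fun x => funext fun j => ?_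
    change ((K j).d i' i'').hom (((K j).d i i').hom (x j)) = 0
    rw [← ModuleCat.comp_apply]
    simp

/-- The projections of a product of complexes. -/
def piCxProj {J : Type} (K : J → Cx.{u}) (j : J) : piCx K ⟶ K j where
  f _ := ModuleCat.ofHom (LinearMap.proj j)
  comm' _ _ _ := rfl

/-- The map to a product of complexes with given components. -/
def piCxLift {J : Type} (K : J → Cx.{u}) {L : Cx.{u}} (f : ∀ j, L ⟶ K j) : L ⟶ piCx K where
  f i := ModuleCat.ofHom (LinearMap.pi fun j => ((f j).f i).hom)
  comm' i i' _ := by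
    apply ModuleCat.hom_ext
    refine LinearMap.ext fun x => funext fun j => ?_
    exact (map_d (f j) i i' x).symm

/-- The product cone of a family of complexes. -/
def piCxCone {J : Type} (K : Discrete J ⥤ Cx.{u}) : Cone K where
  pt := piCx fun j => K.obj ⟨j⟩
  π := Discrete.natTrans fun j => piCxProj (fun j => K.obj ⟨j⟩) j.as

/-- The product cone of complexes is a limit cone. -/
def piCxConeIsLimit {J : Type} (K : Discrete J ⥤ Cx.{u}) : IsLimit (piCxCone K) where
  lift s := piCxLift _ fun j => s.π.app ⟨j⟩
  fac s j := rfl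
  uniq s m hm := by
    ext i x
    refine funext fun j => ?_
    have := congrArg (fun α => (α.f i).hom x) (hm ⟨j⟩)
    exact this

namespace DGBimod

variable {C : Type u} [DGCategory C] {J : Type}

/-- The product of a family of dg-bimodules. -/
def pi (M : J → DGBimod C) : DGBimod C where
  obj X Y := piCx fun j => (M j).obj X Y
  lact h := LinearMap.mk₂ ℂ (fun g m j => (M j).lact h g (m j))
    (fun _ _ _ => funext fun _ => LinearMap.map_add₂ _ _ _ _)
    (fun _ _ _ => funext fun _ => LinearMap.map_smul₂ _ _ _ _)
    (fun _ _ _ => funext fun _ => map_add _ _ _) (fun _ _ _ => funext fun _ => map_smul _ _ _)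
  ract h := LinearMap.mk₂ ℂ (fun m f j => (M j).ract h (m j) f)
    (fun _ _ _ => funext fun _ => LinearMap.map_add₂ _ _ _ _)
    (fun _ _ _ => funext fun _ => LinearMap.map_smul₂ _ _ _ _)
    (fun _ _ _ => funext fun _ => map_add _ _ _) (fun _ _ _ => funext fun _ => map_smul _ _ _)
  one_lact m := funext fun j => (M j).one_lact (m j)
  ract_one m := funext fun j => (M j).ract_one (m j)
  lact_comp h₁ h₂ h₃ h₄ h g m := funext fun j => (M j).lact_comp h₁ h₂ h₃ h₄ h g (m j)
  lact_ract h₁ h₂ h₃ h₄ g m f := funext fun j => (M j).lact_ract h₁ h₂ h₃ h₄ g (m j) f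
  ract_comp h₁ h₂ h₃ h₄ m g f := funext fun j => (M j).ract_comp h₁ h₂ h₃ h₄ (m j) g f
  lact_leibniz h h₁ h₂ hi hj g m :=
    funext fun j => (M j).lact_leibniz h h₁ h₂ hi hj g (m j)
  ract_leibniz h h₁ h₂ hi hj m f :=
    funext fun j => (M j).ract_leibniz h h₁ h₂ hi hj (m j) f

/-- The projections of a product of dg-bimodules. -/
def piProj (M : J → DGBimod C) (j : J) : pi M ⟶ M j where
  app X Y := piCxProj (fun j => (M j).obj X Y) j
  map_lact _ _ _ := rfl
  map_ract _ _ _ := rfl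

/-- The morphism to a product of dg-bimodules with given components. -/
def piLift (M : J → DGBimod C) {N : DGBimod C} (f : ∀ j, N ⟶ M j) : N ⟶ pi M where
  app X Y := piCxLift _ fun j => (f j).app X Y
  map_lact h g m := funext fun j => (f j).map_lact h g m
  map_ract h m g := funext fun j => (f j).map_ract h m g

/-- The product cone of a family of dg-bimodules. -/
def piCone (F : Discrete J ⥤ DGBimod C) : Cone F where
  pt := pi fun j => F.obj ⟨j⟩
  π := Discrete.natTrans fun j => piProj (fun j => F.obj ⟨j⟩) j.as

/-- The product cone of dg-bimodules is a limit cone. -/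
def piConeIsLimit (F : Discrete J ⥤ DGBimod C) : IsLimit (piCone F) where
  lift s := piLift _ fun j => s.π.app ⟨j⟩
  fac s j := rfl
  uniq s m hm := hom_ext fun X Y i x => funext fun j => by
    have := congrArg (fun α => ((α.app X Y).f i).hom x) (hm ⟨j⟩)
    exact this

instance : HasProductsOfShape J (DGBimod C) where
  has_limit F := ⟨⟨piCone F, piConeIsLimit F⟩⟩

/-- The functor `M ↦ M(X, Y)`. -/
def evaluation (X Y : C) : DGBimod C ⥤ Cx.{u} where
  obj M := M.obj X Y
  map α := α.app X Y
  map_id _ := rfl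
  map_comp _ _ := rfl

instance (X Y : C) : PreservesLimitsOfShape (Discrete J) (evaluation X Y) where
  preservesLimit {F} := preservesLimit_of_preserves_limit_cone (piConeIsLimit F)
    ((piCxConeIsLimit (F ⋙ evaluation X Y)).ofIsoLimit
      (Cone.ext (Iso.refl _) fun _ => (Category.id_comp _).symm))

/-- Products of bimodules are computed objectwise and homology preserves finite products, so on
homology the map of products is induced by a natural isomorphism of diagrams. This is what lets
`toDerived` preserve finite products. -/
instance [Finite J] : (quasiIso C).IsStableUnderProductsOfShape J where
  condition F₁ F₂ c₁ c₂ h₁ h₂ f hf φ hφ X Y := by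
    rw [quasiIso_iff]
    intro i
    rw [quasiIsoAt_iff_isIso_homologyMap]
    let H := evaluation X Y ⋙ HomologicalComplex.homologyFunctor (ModuleCat.{u} ℂ) (.up ℤ) i
    have : PreservesLimitsOfShape (Discrete J)
        (HomologicalComplex.homologyFunctor (ModuleCat.{u} ℂ) (.up ℤ) i) :=
      inferInstance
    let e : F₁ ⋙ H ≅ F₂ ⋙ H := by
      have : ∀ j, IsIso (H.map (f.app j)) := fun j => by
        have := hf j X Y
        change IsIso (HomologicalComplex.homologyMap ((f.app j).app X Y) i)
        infer_instance
      exact NatIso.ofComponents (fun j => asIso (H.map (f.app j))) fun g => by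
        simp [← Functor.map_comp]
    let e' := (isLimitOfPreserves H h₁).conePointsIsoOfNatIso (isLimitOfPreserves H h₂) e
    have : H.map φ = e'.hom := by
      refine (isLimitOfPreserves H h₂).hom_ext fun j => ?_
      rw [IsLimit.conePointsIsoOfNatIso_hom_comp]
      change H.map _ ≫ H.map _ = H.map _ ≫ H.map _
      rw [← H.map_comp, ← H.map_comp, hφ]
    change IsIso (H.map φ)
    rw [this]
    infer_instance

instance : (quasiIso C).ContainsIdentities where
  id_mem M X Y := by
    change QuasiIso (𝟙 (M.obj X Y))
    infer_instance

/-- Two morphisms to a finite product in the derived category agree if their components do. -/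
theorem derived_pi_hom_ext [Finite J] (M : J → DGBimod C) {X : Derived C}
    {f g : X ⟶ (toDerived C).obj (pi M)}
    (h : ∀ j, f ≫ (toDerived C).map (piProj M j) = g ≫ (toDerived C).map (piProj M j)) :
    f = g := by
  have := Localization.preservesProductsOfShape (toDerived C) (quasiIso C) J
  exact (isLimitOfPreserves (toDerived C) (piConeIsLimit (Discrete.functor M))).hom_ext
    fun j => h j.as

/-- The functor `M ↦ M^J`. -/
def power (J : Type) : DGBimod C ⥤ DGBimod C where
  obj M := pi fun _ : J => M
  map α := piLift _ fun j => piProj _ j ≫ α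
  map_id _ := rfl
  map_comp _ _ := rfl

theorem power_quasiIso [Finite J] ⦃M N : DGBimod C⦄ (α : M ⟶ N) (hα : quasiIso C α) :
    quasiIso C ((power J).map α) :=
  MorphismProperty.IsStableUnderLimitsOfShape.condition (W := quasiIso C) (J := Discrete J)
    (Discrete.functor fun _ => M) (Discrete.functor fun _ => N) _ _
    (piConeIsLimit _) (piConeIsLimit _) (Discrete.natTrans fun _ => α) (fun _ => hα) _
    fun _ => rfl

/-- The projection `M^J → M` as a natural transformation. -/
def powerProj (j : J) : power (C := C) J ⟶ 𝟭 (DGBimod C) where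
  app M := piProj (fun _ => M) j

/-- The averaging map `M^J → M`. -/
def average (J : Type) [Fintype J] : power (C := C) J ⟶ 𝟭 (DGBimod C) where
  app M :=
    { app := fun X Y =>
        { f := fun i => ModuleCat.ofHom ((Fintype.card J : ℂ)⁻¹ • ∑ j : J, LinearMap.proj j)
          comm' := fun i i' _ => by
            apply ModuleCat.hom_ext
            refine LinearMap.ext fun (x : J → (M.obj X Y).X i) => ?_
            change ((M.obj X Y).d i i').hom
                (((Fintype.card J : ℂ)⁻¹ • ∑ j : J, LinearMap.proj (R := ℂ) j) x) =
              ((Fintype.card J : ℂ)⁻¹ • ∑ j : J, LinearMap.proj (R := ℂ) j)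
                fun j => ((M.obj X Y).d i i').hom (x j)
            simp [LinearMap.sum_apply] }
      map_lact := fun {X Y Z i j k} h g (m : J → (M.obj X Y).X j) => by
        change ((Fintype.card J : ℂ)⁻¹ • ∑ j : J, LinearMap.proj (R := ℂ) j)
          (fun j => M.lact h g (m j)) =
            M.lact h g (((Fintype.card J : ℂ)⁻¹ • ∑ j : J, LinearMap.proj (R := ℂ) j) m)
        simp [LinearMap.sum_apply]
      map_ract := fun {X Y Z i j k} h (m : J → (M.obj Y Z).X i) f => by
        change ((Fintype.card J : ℂ)⁻¹ • ∑ j : J, LinearMap.proj (R := ℂ) j)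
          (fun j => M.ract h (m j) f) =
            M.ract h (((Fintype.card J : ℂ)⁻¹ • ∑ j : J, LinearMap.proj (R := ℂ) j) m) f
        simp [LinearMap.sum_apply] }
  naturality M N α := hom_ext fun X Y i (m : J → (M.obj X Y).X i) => by
    change ((Fintype.card J : ℂ)⁻¹ • ∑ j : J, LinearMap.proj (R := ℂ) j)
          (fun j => ((α.app X Y).f i).hom (m j)) = ((α.app X Y).f i).hom
            (((Fintype.card J : ℂ)⁻¹ • ∑ j : J, LinearMap.proj (R := ℂ) j) m)
    simp [LinearMap.sum_apply]

/-- The average of a family of endomorphisms of a dg-bimodule. -/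
def averageEnd [Fintype J] {M : DGBimod C} (s : J → (M ⟶ M)) : M ⟶ M :=
  piLift (fun _ => M) s ≫ ((average J).app M : pi (fun _ : J => M) ⟶ M)

theorem averageEnd_apply [Fintype J] {M : DGBimod C} (s : J → (M ⟶ M)) {X Y : C} {i : ℤ}
    (m : (M.obj X Y).X i) :
    (((averageEnd s).app X Y).f i).hom m =
      (Fintype.card J : ℂ)⁻¹ • ∑ j, (((s j).app X Y).f i).hom m := by
  change ((Fintype.card J : ℂ)⁻¹ • ∑ j : J, LinearMap.proj (R := ℂ) j)
    (fun j => (((s j).app X Y).f i).hom m) = _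
  simp [LinearMap.sum_apply]

/-- A morphism in the derived category intertwines the averages of two families of endomorphisms
if it intertwines their members. -/
theorem derived_average_comm [Fintype J] {M N : DGBimod C} (s : J → (M ⟶ M)) (t : J → (N ⟶ N))
    (α : (toDerived C).obj M ⟶ (toDerived C).obj N)
    (h : ∀ j, α ≫ (toDerived C).map (t j) = (toDerived C).map (s j) ≫ α) :
    α ≫ (toDerived C).map (averageEnd t) = (toDerived C).map (averageEnd s) ≫ α := by
  -- The power `α^J`. Both the projections and the averaging map are natural transformations `M^J →
  -- M` on actual bimodules, so they are natural for derived morphisms as well.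
  let α' : (toDerived C).obj (pi fun _ : J => M) ⟶ (toDerived C).obj (pi fun _ : J => N) :=
    (derivedMap (power J) power_quasiIso).map α
  have h₁ (j : J) : α' ≫ (toDerived C).map (piProj (fun _ => N) j) =
      (toDerived C).map (piProj (fun _ => M) j) ≫ α :=
    (derivedMap_naturality power_quasiIso (fun _ _ _ h => h) (powerProj j) α).trans
      (congrArg ((toDerived C).map (piProj (fun _ => M) j) ≫ ·) (derivedMap_id α))
  let a (L : DGBimod C) : pi (fun _ : J => L) ⟶ L := (average J).app L
  have h₂ : α' ≫ (toDerived C).map (a N) = (toDerived C).map (a M) ≫ α :=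
    (derivedMap_naturality power_quasiIso (fun _ _ _ h => h) (average J) α).trans
      (congrArg ((toDerived C).map (a M) ≫ ·) (derivedMap_id α))
  -- The hypothesis enters here, one component at a time; the average itself is then applied after
  -- `t` and `s`.
  have h₃ : α ≫ (toDerived C).map (piLift (fun _ => N) t) =
      (toDerived C).map (piLift (fun _ => M) s) ≫ α' := by
    refine derived_pi_hom_ext _ fun j => ?_
    rw [Category.assoc, Category.assoc, h₁, ← Functor.map_comp, ← Functor.map_comp_assoc]
    exact h j
  change α ≫ (toDerived C).map (_ ≫ a N) = (toDerived C).map (_ ≫ a M) ≫ α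
  rw [Functor.map_comp, Functor.map_comp, reassoc_of% h₃, h₂, Category.assoc]

end DGBimod

end DG

/-! ### The action of `G` on morphism complexes and its averaging operator -/

namespace DG

open DGCategory DGBimod

section Closed

variable {C : Type u} [DGCategory C]

theorem d_closed_comp {X Y Z : C} (u : (hom Y Z).X 0) (hu : ((hom Y Z).d 0 1).hom u = 0) (i j : ℤ)
    (f : (hom X Y).X i) : ((hom X Z).d i j).hom (comp (zero_add i) u f) =
      comp (zero_add j) u (((hom X Y).d i j).hom f) := by
  by_cases h : i + 1 = j
  · rw [leibniz (zero_add i) (show 1 + i = j by omega) (zero_add j) (zero_add 1) h, hu]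
    simp
  · simp [(hom X Z).shape i j h, (hom X Y).shape i j h]

theorem d_comp_closed {X Y Z : C} (u : (hom X Y).X 0) (hu : ((hom X Y).d 0 1).hom u = 0) (i j : ℤ)
    (f : (hom Y Z).X i) : ((hom X Z).d i j).hom (comp (add_zero i) f u) =
      comp (add_zero j) (((hom Y Z).d i j).hom f) u := by
  by_cases h : i + 1 = j
  · rw [leibniz (add_zero i) (add_zero j) h h (zero_add 1), hu]
    simp
  · simp [(hom X Z).shape i j h, (hom Y Z).shape i j h]

/-- Differentiating `u v = 1` with `u` closed gives `u (dv) = 0`, and `u` is left cancellable. -/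
theorem closed_of_comp_eq_one {X Y : C} {u : (hom X Y).X 0} {v : (hom Y X).X 0}
    (hu : ((hom X Y).d 0 1).hom u = 0) (huv : comp (add_zero 0) u v = one Y)
    (hvu : comp (add_zero 0) v u = one X) : ((hom Y X).d 0 1).hom v = 0 := by
  have h : comp (zero_add 1) u (((hom Y X).d 0 1).hom v) = 0 := by
    rw [← d_closed_comp u hu, huv, d_one]
  calc _ = comp (zero_add 1) (comp (zero_add 0) v u) (((hom Y X).d 0 1).hom v) := by
        rw [hvu, one_comp]
    _ = 0 := by rw [assoc (zero_add 0) (zero_add 1) (zero_add 1) (zero_add 1), h, map_zero]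

theorem DGFunctor.map_d {D : Type u} [DGCategory D] (F : DGFunctor C D) {X Y : C} (i j : ℤ)
    (f : (hom X Y).X i) : ((F.map X Y).f j).hom (((hom X Y).d i j).hom f) =
      ((hom _ _).d i j).hom (((F.map X Y).f i).hom f) :=
  DGBimod.map_d _ _ _ _

end Closed

namespace DGBimod

variable {C : Type u} [DGCategory C] (M : DGBimod C)

theorem d_closed_lact {X Y Z : C} (u : (hom Y Z).X 0) (hu : ((hom Y Z).d 0 1).hom u = 0) (i j : ℤ)
    (m : (M.obj X Y).X i) : ((M.obj X Z).d i j).hom (M.lact (zero_add i) u m) =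
      M.lact (zero_add j) u (((M.obj X Y).d i j).hom m) := by
  by_cases h : i + 1 = j
  · rw [M.lact_leibniz (zero_add i) (show 1 + i = j by omega) (zero_add j) (zero_add 1) h, hu]
    simp
  · simp [(M.obj X Z).shape i j h, (M.obj X Y).shape i j h]

theorem d_ract_closed {X Y Z : C} (u : (hom X Y).X 0) (hu : ((hom X Y).d 0 1).hom u = 0) (i j : ℤ)
    (m : (M.obj Y Z).X i) : ((M.obj X Z).d i j).hom (M.ract (add_zero i) m u) =
      M.ract (add_zero j) (((M.obj Y Z).d i j).hom m) u := by
  by_cases h : i + 1 = j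
  · rw [M.ract_leibniz (add_zero i) (add_zero j) h h (zero_add 1), hu]
    simp
  · simp [(M.obj X Z).shape i j h, (M.obj Y Z).shape i j h]

end DGBimod

namespace Equivariant

variable {G : Type u} [Group G] {C : Type u} [DGCategory C] {ρ : DGAction G C}

/-- The inverse of the linearization. -/
def ψ (A : Equivariant ρ) (g : G) : (hom ((ρ.F g).obj A.obj) A.obj).X 0 :=
  (A.isDGIso_φ g).2.choose

theorem ψ_φ (A : Equivariant ρ) (g : G) : comp (add_zero 0) (A.ψ g) (A.φ g) = one A.obj :=
  (A.isDGIso_φ g).2.choose_spec.1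

theorem φ_ψ (A : Equivariant ρ) (g : G) : comp (add_zero 0) (A.φ g) (A.ψ g) = one _ :=
  (A.isDGIso_φ g).2.choose_spec.2

theorem d_φ (A : Equivariant ρ) (g : G) : ((hom _ _).d 0 1).hom (A.φ g) = 0 :=
  (A.isDGIso_φ g).1

theorem d_ψ (A : Equivariant ρ) (g : G) : ((hom _ _).d 0 1).hom (A.ψ g) = 0 :=
  closed_of_comp_eq_one (A.d_φ g) (A.φ_ψ g) (A.ψ_φ g)

/-- The action `f ↦ φ_g⁻¹ ∘ ρ_g(f) ∘ φ_g` of `G` on `C(A, B)`. -/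
def act (g : G) (A B : Equivariant ρ) (i : ℤ) :
    (hom A.obj B.obj).X i →ₗ[ℂ] (hom A.obj B.obj).X i :=
  comp (zero_add i) (B.ψ g) ∘ₗ (comp (add_zero i)).flip (A.φ g) ∘ₗ
    (((ρ.F g).map A.obj B.obj).f i).hom

theorem act_apply (g : G) (A B : Equivariant ρ) (i : ℤ) (f : (hom A.obj B.obj).X i) :
    act g A B i f = comp (zero_add i) (B.ψ g)
      (comp (add_zero i) ((((ρ.F g).map _ _).f i).hom f) (A.φ g)) := rfl

theorem φ_comp_act (g : G) (A B : Equivariant ρ) (i : ℤ) (f : (hom A.obj B.obj).X i) :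
    comp (zero_add i) (B.φ g) (act g A B i f) =
      comp (add_zero i) ((((ρ.F g).map _ _).f i).hom f) (A.φ g) := by
  rw [act_apply, ← DGCategory.assoc (add_zero 0) (zero_add i) (zero_add i) (zero_add i), φ_ψ,
    one_comp]

/-- This equation characterizes `act` without the inverse linearization; the identities for `act`
below are checked in this form. -/
theorem eq_act_iff (g : G) (A B : Equivariant ρ) (i : ℤ) (f f' : (hom A.obj B.obj).X i) :
    f' = act g A B i f ↔ comp (zero_add i) (B.φ g) f' =
      comp (add_zero i) ((((ρ.F g).map _ _).f i).hom f) (A.φ g) := by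
  refine ⟨fun h => by rw [h, φ_comp_act], fun h => ?_⟩
  rw [act_apply, ← h, ← DGCategory.assoc (add_zero 0) (zero_add i) (zero_add i) (zero_add i), ψ_φ,
    one_comp]

theorem mem_invariants_iff (A B : Equivariant ρ) (i : ℤ) (f : (hom A.obj B.obj).X i) :
    f ∈ invariants A B i ↔ ∀ g, act g A B i f = f :=
  forall_congr' fun g => (eq_act_iff g A B i f f).symm.trans eq_comm

theorem d_act (g : G) (A B : Equivariant ρ) (i j : ℤ) (f : (hom A.obj B.obj).X i) :
    ((hom A.obj B.obj).d i j).hom (act g A B i f) =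
      act g A B j (((hom A.obj B.obj).d i j).hom f) := by
  rw [eq_act_iff, ← d_closed_comp _ (B.d_φ g), φ_comp_act, d_comp_closed _ (A.d_φ g),
    DGFunctor.map_d]

/-- Conjugation is multiplicative and fixes the invariant morphism `b`. Thus the action is linear
over `C_G`, which is what makes `actDiag` a bimodule morphism. -/
theorem act_comp_left (g : G) {A B D : Equivariant ρ} {i j k : ℤ} (h : i + j = k)
    (b : (hom B.obj D.obj).X i) (hb : b ∈ invariants B D i) (f : (hom A.obj B.obj).X j) :
    act g A D k (comp h b f) = comp h b (act g A B j f) := by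
  rw [eq_comm, eq_act_iff, ← DGCategory.assoc (zero_add i) h h (zero_add k), hb g,
    DGCategory.assoc (add_zero i) (zero_add j) h h, φ_comp_act, (ρ.F g).map_comp,
    DGCategory.assoc h (add_zero j) (add_zero k) h]

theorem act_comp_right (g : G) {A B D : Equivariant ρ} {i j k : ℤ} (h : i + j = k)
    (f : (hom B.obj D.obj).X i) (b : (hom A.obj B.obj).X j) (hb : b ∈ invariants A B j) :
    act g A D k (comp h f b) = comp h (act g B D i f) b := by
  rw [eq_comm, eq_act_iff, ← DGCategory.assoc (zero_add i) h h (zero_add k), φ_comp_act,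
    DGCategory.assoc (add_zero i) (zero_add j) h h, hb g, (ρ.F g).map_comp,
    DGCategory.assoc h (add_zero j) (add_zero k) h]

/-- The cocycle condition replaces `φ_k` by `θ ∘ ρ_g(φ_h) ∘ φ_g` on both sides, and naturality of
`θ` carries `ρ_g ρ_h(f)` over to `ρ_k(f)`. -/
theorem act_act {g h k : G} (e : g * h = k) (A B : Equivariant ρ) (i : ℤ)
    (f : (hom A.obj B.obj).X i) : act g A B i (act h A B i f) = act k A B i f := by
  have a₀ := add_zero i
  have a₁ := zero_add i
  have h₀ := add_zero (0 : ℤ)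
  rw [eq_act_iff, B.cocycle e, A.cocycle e, DGCategory.assoc h₀ a₁ a₁ a₁,
    DGCategory.assoc h₀ a₁ a₁ a₁, φ_comp_act, ← DGCategory.assoc a₁ a₀ a₀ a₁,
    ← (ρ.F g).map_comp, φ_comp_act, (ρ.F g).map_comp, DGCategory.assoc a₀ h₀ a₀ a₀,
    ← DGCategory.assoc a₁ a₀ a₀ a₁, ρ.naturality e, DGCategory.assoc a₀ h₀ a₀ a₀]

/-- The data contain no unit constraint for `ρ_1`. Instead `act 1` is idempotent, which after
cancelling `φ_1` reads `ρ_1(act 1 f) = ρ_1(f)`, and `ρ_1` is faithful. -/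
theorem act_one (A B : Equivariant ρ) (i : ℤ) (f : (hom A.obj B.obj).X i) :
    act 1 A B i f = f := by
  have hρ : Function.Injective (((ρ.F 1).map A.obj B.obj).f i).hom := by
    have := (ρ.isEquiv 1).isIso_map A.obj B.obj
    exact ((ConcreteCategory.isIso_iff_bijective (((ρ.F 1).map A.obj B.obj).f i)).1
      inferInstance).1
  have h := φ_comp_act 1 A B i (act 1 A B i f)
  rw [act_act (mul_one 1), φ_comp_act] at h
  have h' := congrArg (fun x => comp (add_zero i) x (A.ψ 1)) h
  simp only [DGCategory.assoc (add_zero i) (add_zero 0) (add_zero i) (add_zero i), φ_ψ,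
    comp_one] at h'
  exact (hρ h').symm

/-- The action of `G` on the bimodule `(A, B) ↦ C(A, B)` over `C_G`. -/
def actDiag (ρ : DGAction G C) (g : G) :
    (pullback (forget ρ)).obj (diag C) ⟶ (pullback (forget ρ)).obj (diag C) where
  app A B :=
    { f := fun i => ModuleCat.ofHom (act g A B i)
      comm' := fun i j _ => by
        ext f
        exact d_act g A B i j f }
  map_lact h b f := act_comp_left g h b.1 b.2 f
  map_ract h f b := act_comp_right g h f b.1 b.2

theorem actDiag_comp {g h k : G} (e : g * h = k) :
    actDiag ρ h ≫ actDiag ρ g = actDiag ρ k :=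
  hom_ext fun A B i f => act_act e A B i f

theorem actDiag_one : actDiag ρ 1 = 𝟙 _ :=
  hom_ext fun A B i f => act_one A B i f

/-- The isomorphism `m ↦ φ_g m φ_g⁻¹` between the pullbacks of a bimodule along the forgetful
functor `p : C_G → C` and along `ρ_g p`. -/
def linearize (ρ : DGAction G C) (g : G) :
    pullback (forget ρ) ⟶ pullback (ρ.F g) ⋙ pullback (forget ρ) where
  app M :=
    { app := fun A B =>
        { f := fun i => ModuleCat.ofHom
            (M.lact (zero_add i) (B.φ g) ∘ₗ (M.ract (add_zero i)).flip (A.ψ g))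
          comm' := fun i j _ => by
            apply ModuleCat.hom_ext
            refine LinearMap.ext fun (m : (M.obj A.obj B.obj).X i) => ?_
            change ((M.obj _ _).d i j).hom (M.lact (zero_add i) (B.φ g)
              (M.ract (add_zero i) m (A.ψ g))) = M.lact (zero_add j) (B.φ g)
                (M.ract (add_zero j) (((M.obj A.obj B.obj).d i j).hom m) (A.ψ g))
            rw [d_closed_lact M _ (B.d_φ g), d_ract_closed M _ (A.d_ψ g)] }
      map_lact := fun {A B D i j k} h b (m : (M.obj A.obj B.obj).X j) => by
        change M.lact (zero_add k) (D.φ g) (M.ract (add_zero k) (M.lact h b.1 m) (A.ψ g)) =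
          M.lact h ((((ρ.F g).map _ _).f i).hom b.1)
            (M.lact (zero_add j) (B.φ g) (M.ract (add_zero j) m (A.ψ g)))
        rw [M.lact_ract h (add_zero j) (add_zero k) h,
          ← M.lact_comp (zero_add i) h h (zero_add k), b.2 g,
          M.lact_comp (add_zero i) (zero_add j) h h]
      map_ract := fun {A B D i j k} h (m : (M.obj B.obj D.obj).X i) b => by
        -- Invariance of `b` rewritten for the inverse linearizations, since the right action meets
        -- `φ_g⁻¹`.
        have hb : comp (add_zero j) b.1 (A.ψ g) =
            comp (zero_add j) (B.ψ g) ((((ρ.F g).map _ _).f j).hom b.1) := by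
          have h₁ := congrArg (fun x => comp (zero_add j) (B.ψ g) (comp (add_zero j) x (A.ψ g)))
            (b.2 g)
          simp only [DGCategory.assoc (add_zero j) (add_zero 0) (add_zero j) (add_zero j), φ_ψ,
            comp_one, DGCategory.assoc (zero_add j) (add_zero j) (add_zero j) (zero_add j)] at h₁
          rwa [← DGCategory.assoc (add_zero 0) (zero_add j) (zero_add j) (zero_add j), ψ_φ,
            one_comp] at h₁
        change M.lact (zero_add k) (D.φ g) (M.ract (add_zero k) (M.ract h m b.1) (A.ψ g)) =
          M.ract h (M.lact (zero_add i) (D.φ g) (M.ract (add_zero i) m (B.ψ g)))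
            ((((ρ.F g).map _ _).f j).hom b.1)
        rw [M.ract_comp h (add_zero j) (add_zero k) h, hb,
          M.lact_ract (zero_add i) h h (zero_add k),
          M.ract_comp (add_zero i) (zero_add j) h h] }
  naturality M N α := hom_ext fun A B i (m : (M.obj A.obj B.obj).X i) => by
    change N.lact (zero_add i) (B.φ g)
        (N.ract (add_zero i) (((α.app A.obj B.obj).f i).hom m) (A.ψ g)) =
      ((α.app _ _).f i).hom (M.lact (zero_add i) (B.φ g) (M.ract (add_zero i) m (A.ψ g)))
    rw [α.map_lact, α.map_ract]

/-- Linearizing undoes the conjugation by `φ_g` and leaves the bare map `ρ_g`. Together with the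
definition of `actCodiag` it reduces equivariance to naturality of `linearize`. -/
theorem actDiag_linearize (g : G) : actDiag ρ g ≫ (linearize ρ g).app (diag C) =
    (pullback (forget ρ)).map (diagMap (ρ.F g)) :=
    hom_ext fun A B i (f : (hom A.obj B.obj).X i) => by
  change comp (zero_add i) (B.φ g) (comp (add_zero i) (act g A B i f) (A.ψ g)) =
    (((ρ.F g).map _ _).f i).hom f
  rw [← DGCategory.assoc (zero_add i) (add_zero i) (add_zero i) (zero_add i), φ_comp_act,
    DGCategory.assoc (add_zero i) (add_zero 0) (add_zero i) (add_zero i), φ_ψ, comp_one]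

/-- The dual action of `G` on the bimodule `(A, B) ↦ C(B, A)^∨` over `C_G`. -/
def actCodiag (ρ : DGAction G C) (g : G) :
    (pullback (forget ρ)).obj (codiag C) ⟶ (pullback (forget ρ)).obj (codiag C) :=
  (linearize ρ g).app (codiag C) ≫ (pullback (forget ρ)).map (codiagMap (ρ.F g))

/-- The dual action is precomposition with `act g`, hence contravariant in `g`; this is the source
of the inverses in `pairing_comp_act`. -/
theorem actCodiag_apply (g : G) {A B : Equivariant ρ} {i : ℤ}
    (ξ : Module.Dual ℂ ((hom B.obj A.obj).X (-i))) (x : (hom B.obj A.obj).X (-i)) :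
    DFunLike.coe (F := Module.Dual ℂ ((hom B.obj A.obj).X (-i)))
      ((((actCodiag ρ g).app A B).f i).hom ξ) x = ξ (act g B A (-i) x) := by
  change (0 : ℤ).negOnePow • ξ (comp (zero_add (-i)) (A.ψ g) (comp (add_zero (-i))
    ((((ρ.F g).map _ _).f (-i)).hom x) (B.φ g))) = _
  rw [Int.negOnePow_zero, one_smul]
  rfl

/-- The shift twists the left action by the sign `(-1)^{k|g|}`, which is trivial here because
linearizations have degree `0`. -/
theorem shift_actCodiag (g : G) (k : ℤ) :
    (shift k).map (actCodiag ρ g) = (linearize ρ g).app ((shift k).obj (codiag C)) ≫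
      (pullback (forget ρ)).map (X := (pullback (ρ.F g)).obj ((shift k).obj (codiag C)))
        ((shift k).map (codiagMap (ρ.F g))) := hom_ext fun A B i ξ => by
  let y := (codiag C).lact (zero_add (i + k)) (B.φ g)
    ((codiag C).ract (add_zero (i + k)) ξ (A.ψ g))
  have h : (k * 0).negOnePow • y = y := by rw [mul_zero, Int.negOnePow_zero, one_smul]
  exact congrArg (((codiagMap (ρ.F g)).app A.obj B.obj).f (i + k)).hom h.symm

variable [Fintype G]

/-- The averaging operator on `C(A, B)`. -/
def reynolds (A B : Equivariant ρ) (i : ℤ) : (hom A.obj B.obj).X i →ₗ[ℂ] invariants A B i :=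
  ((Fintype.card G : ℂ)⁻¹ • ∑ g : G, act g A B i).codRestrict _ fun f => by
    rw [mem_invariants_iff]
    intro h
    rw [LinearMap.smul_apply, map_smul, LinearMap.sum_apply, map_sum]
    congr 1
    exact Fintype.sum_equiv (Equiv.mulLeft h) _ _ fun g => act_act rfl A B i f

theorem reynolds_apply (A B : Equivariant ρ) (i : ℤ) (f : (hom A.obj B.obj).X i) :
    (reynolds A B i f).1 = (Fintype.card G : ℂ)⁻¹ • ∑ g : G, act g A B i f := by
  change ((Fintype.card G : ℂ)⁻¹ • ∑ g : G, act g A B i) f = _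
  rw [LinearMap.smul_apply, LinearMap.sum_apply]

theorem reynolds_coe (A B : Equivariant ρ) (i : ℤ) (f : invariants A B i) :
    reynolds A B i f.1 = f := by
  apply Subtype.ext
  rw [reynolds_apply, Finset.sum_congr rfl fun g _ => (mem_invariants_iff A B i f.1).1 f.2 g,
    Finset.sum_const, Finset.card_univ, ← Nat.cast_smul_eq_nsmul ℂ, smul_smul,
    inv_mul_cancel₀ (Nat.cast_ne_zero.2 Fintype.card_ne_zero), one_smul]

theorem reynolds_comp_left {A B D : Equivariant ρ} {i j k : ℤ} (h : i + j = k)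
    (b : invariants B D i) (f : (hom A.obj B.obj).X j) :
    reynolds A D k (comp h b.1 f) = compInv h b (reynolds A B j f) := by
  apply Subtype.ext
  change (reynolds A D k (comp h b.1 f)).1 = comp h b.1 (reynolds A B j f).1
  simp only [reynolds_apply, act_comp_left _ h b.1 b.2, map_smul, map_sum]

theorem reynolds_comp_right {A B D : Equivariant ρ} {i j k : ℤ} (h : i + j = k)
    (f : (hom B.obj D.obj).X i) (b : invariants A B j) :
    reynolds A D k (comp h f b.1) = compInv h (reynolds B D i f) b := by
  apply Subtype.ext
  change (reynolds A D k (comp h f b.1)).1 = comp h (reynolds B D i f).1 b.1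
  simp only [reynolds_apply, act_comp_right _ h f b.1 b.2, map_smul, map_sum,
    LinearMap.smul_apply, LinearMap.sum_apply]

/-- The averaging operator as a morphism of bimodules over `C_G`. -/
def reynoldsDiag (ρ : DGAction G C) :
    (pullback (forget ρ)).obj (diag C) ⟶ diag (Equivariant ρ) where
  app A B :=
    { f := fun i => ModuleCat.ofHom (reynolds A B i)
      comm' := fun i j _ => by
        apply ModuleCat.hom_ext
        refine LinearMap.ext fun (f : (hom A.obj B.obj).X i) => Subtype.ext ?_
        change ((hom A.obj B.obj).d i j).hom (reynolds A B i f).1 =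
          (reynolds A B j (((hom A.obj B.obj).d i j).hom f)).1
        simp only [reynolds_apply, map_smul, map_sum, d_act] }
  map_lact h b f := reynolds_comp_left h b f
  map_ract h f b := reynolds_comp_right h f b

/-- The dual of the averaging operator. -/
def reynoldsCodiag (ρ : DGAction G C) :
    codiag (Equivariant ρ) ⟶ (pullback (forget ρ)).obj (codiag C) where
  app A B := dualCxMap ((reynoldsDiag ρ).app B A)
  map_lact {A B _ i j _} _ b (ξ : Module.Dual ℂ (invariants B A (-j))) :=
    LinearMap.ext fun x => congrArg (i.negOnePow • ξ ·) (reynolds_comp_right _ x b).symm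
  map_ract {_ B D i _ _} _ (ξ : Module.Dual ℂ (invariants D B (-i))) b :=
    LinearMap.ext fun x => congrArg ξ (reynolds_comp_left _ b x).symm

/-- This and its dual exhibit the diagonal bimodule of `C_G` and its dual as retracts of bimodules
pulled back from `C`. -/
theorem diagMap_reynoldsDiag : diagMap (forget ρ) ≫ reynoldsDiag ρ = 𝟙 _ :=
  hom_ext fun A B i f => reynolds_coe A B i f

theorem reynoldsCodiag_codiagMap : reynoldsCodiag ρ ≫ codiagMap (forget ρ) = 𝟙 _ :=
  hom_ext fun A B i (ξ : Module.Dual ℂ (invariants B A (-i))) => LinearMap.ext fun x =>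
    congrArg ξ (reynolds_coe B A (-i) x)

end Equivariant

end DG

/-! ### Equivariance of the pairing and its restriction to `C_G` -/

namespace DG

open DGCategory DGBimod

namespace DGBimod

variable {C D : Type u} [DGCategory C] [DGCategory D]

theorem derivedPullback_map (F : DGFunctor D C) {M N : DGBimod C} (α : M ⟶ N) :
    (derivedPullback F).map ((toDerived C).map α) = (toDerived D).map ((pullback F).map α) :=
  derivedMap_map _ _ α

theorem derivedShift_map (k : ℤ) {M N : DGBimod C} (α : M ⟶ N) :
    (derivedShift C k).map ((toDerived C).map α) = (toDerived C).map ((shift k).map α) :=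
  derivedMap_map _ _ α

/-- The map `α ↦ F^∨ ∘ α ∘ F` induced by a dg-functor `F` on the morphisms from the diagonal
bimodule to a shift of its dual. -/
def restrictPairing (F : DGFunctor D C) {k : ℤ}
    (α : (toDerived C).obj (diag C) ⟶ (toDerived C).obj ((shift k).obj (codiag C))) :
    (toDerived D).obj (diag D) ⟶ (toDerived D).obj ((shift k).obj (codiag D)) :=
  (toDerived D).map (diagMap F) ≫ (derivedPullback F).map α ≫
    (toDerived D).map ((shift k).map (codiagMap F))

/-- Separates the pairing, which involves no Serre functor on `D`, from the final identification by
the duality of `T`. -/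
theorem pullHH_eq (F : DGFunctor D C) (S : SerreFunctor C) (T : SerreFunctor D) {k : ℤ}
    (a : HH S.bimod k) : pullHH F S T a =
      restrictPairing F (a ≫ (derivedShift C k).map S.duality.hom) ≫
        (derivedShift D k).map T.duality.inv := by
  have h : (derivedShift D k).map ((toDerived D).map (codiagMap F) ≫ T.duality.inv) =
      (toDerived D).map ((shift k).map (codiagMap F)) ≫ (derivedShift D k).map T.duality.inv :=
    (Functor.map_comp _ _ _).trans
      (congrArg (· ≫ (derivedShift D k).map T.duality.inv) (derivedShift_map k (codiagMap F)))
  exact (congrArg (fun x => (toDerived D).map (diagMap F) ≫ (derivedPullback F).map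
    (a ≫ (derivedShift C k).map S.duality.hom) ≫ x) h).trans
      ((Category.assoc _ _ _).trans (congrArg _ (Category.assoc _ _ _))).symm

theorem pullHH_comp_duality (F : DGFunctor D C) (S : SerreFunctor C) (T : SerreFunctor D) {k : ℤ}
    (a : HH S.bimod k) : pullHH F S T a ≫ (derivedShift D k).map T.duality.hom =
      restrictPairing F (a ≫ (derivedShift C k).map S.duality.hom) := by
  have h : (derivedShift D k).map T.duality.inv ≫ (derivedShift D k).map T.duality.hom = 𝟙 _ := by
    rw [← Functor.map_comp, T.duality.inv_hom_id, CategoryTheory.Functor.map_id]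
  rw [pullHH_eq]
  exact (Category.assoc _ _ _).trans ((congrArg _ h).trans (Category.comp_id _))

end DGBimod

namespace Equivariant

variable {G : Type u} [Group G] {C : Type u} [DGCategory C] {ρ : DGAction G C}

/-- The diagram chase for `act_comp_pairing`: `t`, `t'` are the two actions, `l`, `l'` the
linearizations, and `d`, `c` come from `ρ_g` and its dual. -/
theorem twisted_naturality {E : Type*} [Category E] {M N M' N' : E} {t : M ⟶ M} {t' : N ⟶ N}
    {a : M ⟶ N} {a' : M' ⟶ N'} {l : M ⟶ M'} {l' : N ⟶ N'} {d : M ⟶ M'} {c : N' ⟶ N}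
    (h : a ≫ l' = l ≫ a') (ht : t ≫ l = d) (ht' : t' = l' ≫ c) (ha : d ≫ a' ≫ c = a) :
    t ≫ a ≫ t' = a := by
  rw [ht', reassoc_of% h, reassoc_of% ht, ha]

/-- By naturality of `linearize`, the left side is the pullback along `p` of `restrictPairing (ρ.F
g) α`, which is `α`. -/
theorem act_comp_pairing {k : ℤ}
    (α : (toDerived C).obj (diag C) ⟶ (toDerived C).obj ((shift k).obj (codiag C))) (g : G)
    (hα : restrictPairing (ρ.F g) α = α) :
    (toDerived (Equivariant ρ)).map (actDiag ρ g) ≫ (derivedPullback (forget ρ)).map α ≫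
      (toDerived (Equivariant ρ)).map ((shift k).map (actCodiag ρ g)) =
        (derivedPullback (forget ρ)).map α := by
  let Q := toDerived (Equivariant ρ)
  let P := pullback (forget ρ)
  let DP := derivedPullback (forget ρ)
  let R := pullback (ρ.F g)
  let DR := derivedPullback (ρ.F g)
  let l := linearize ρ g
  let γ : R.obj ((shift k).obj (codiag C)) ⟶ (shift k).obj (codiag C) :=
    (shift k).map (codiagMap (ρ.F g))
  have h₁ : DP.map α ≫ Q.map (l.app ((shift k).obj (codiag C))) =
      Q.map (l.app (diag C)) ≫ DP.map (DR.map α) :=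
    (derivedMap_naturality (fun _ _ _ h X Y => h _ _) (fun _ _ _ h X Y => h _ _) l α).trans
      (congrArg (Q.map (l.app (diag C)) ≫ ·) (derivedMap_comp _ _ _ _ α).symm)
  have h₂ : Q.map ((shift k).map (actCodiag ρ g)) =
      Q.map (l.app ((shift k).obj (codiag C))) ≫ Q.map (P.map γ) :=
    (congrArg Q.map (shift_actCodiag g k)).trans (Q.map_comp _ _)
  have h₃ : Q.map (actDiag ρ g) ≫ Q.map (l.app (diag C)) =
      DP.map ((toDerived C).map (diagMap (ρ.F g))) :=
    (Q.map_comp _ _).symm.trans ((congrArg Q.map (actDiag_linearize g)).trans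
      (derivedPullback_map _ _).symm)
  have h₄ : Q.map (P.map γ) = DP.map ((toDerived C).map γ) := (derivedPullback_map _ _).symm
  let β : (toDerived C).obj (R.obj (diag C)) ⟶
    (toDerived C).obj (R.obj ((shift k).obj (codiag C))) := DR.map α
  have h₅ : DP.map ((toDerived C).map (diagMap (ρ.F g))) ≫ DP.map β ≫
      DP.map ((toDerived C).map γ) = DP.map α := by
    rw [← DP.map_comp, ← DP.map_comp]
    exact congrArg DP.map hα
  exact twisted_naturality h₁ h₃ (h₂.trans (congrArg _ h₄)) h₅

/-- `act_comp_pairing` for `g⁻¹`, with the action of `g⁻¹` on the source moved to the other side. -/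
theorem pairing_comp_act {k : ℤ}
    (α : (toDerived C).obj (diag C) ⟶ (toDerived C).obj ((shift k).obj (codiag C))) (g : G)
    (hα : restrictPairing (ρ.F g⁻¹) α = α) :
    (derivedPullback (forget ρ)).map α ≫
      (toDerived (Equivariant ρ)).map ((shift k).map (actCodiag ρ g⁻¹)) =
        (toDerived (Equivariant ρ)).map (actDiag ρ g) ≫ (derivedPullback (forget ρ)).map α := by
  have h : (toDerived (Equivariant ρ)).map (actDiag ρ g) ≫
      (toDerived (Equivariant ρ)).map (actDiag ρ g⁻¹) = 𝟙 _ := by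
    rw [← Functor.map_comp, actDiag_comp (inv_mul_cancel g), actDiag_one,
      CategoryTheory.Functor.map_id]
  have h' := congrArg ((toDerived (Equivariant ρ)).map (actDiag ρ g) ≫ ·)
    (act_comp_pairing α g⁻¹ hα)
  exact ((Category.id_comp _).symm.trans (congrArg (· ≫ _) h.symm)).trans
    ((Category.assoc _ _ _).trans h')

variable [Fintype G]

theorem reynoldsDiag_diagMap {J : Type} [Fintype J] (e : J ≃ G) :
    reynoldsDiag ρ ≫ diagMap (forget ρ) = averageEnd fun j => actDiag ρ (e j) :=
  hom_ext fun A B i (f : (hom A.obj B.obj).X i) => by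
    refine (reynolds_apply A B i f).trans 
      (Eq.trans ?_ (averageEnd_apply (fun j => actDiag ρ (e j)) f).symm)
    rw [Fintype.card_congr e]
    congr 1
    exact (Fintype.sum_equiv e _ _ fun _ => rfl).symm

/-- The sum over `G` is reindexed by inversion, so that its terms match the operators that
`pairing_comp_act` pairs with `actDiag ρ (e j)`. -/
theorem shift_codiagMap_reynoldsCodiag {J : Type} [Fintype J] (e : J ≃ G) (k : ℤ) :
    (shift k).map (codiagMap (forget ρ) ≫ reynoldsCodiag ρ) =
      averageEnd fun j => (shift k).map (actCodiag ρ (e j)⁻¹) :=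
  hom_ext fun A B i (ξ : Module.Dual ℂ ((hom B.obj A.obj).X (-(i + k)))) => by
    refine Eq.trans ?_ (averageEnd_apply _ _).symm
    rw [Fintype.card_congr e]
    refine LinearMap.ext fun x => ?_
    refine (congrArg ξ (reynolds_apply B A _ x)).trans ?_
    rw [map_smul, map_sum]
    refine Eq.trans ?_ (LinearMap.smul_apply _ _ _).symm
    refine congrArg _ (Eq.trans ?_ (LinearMap.sum_apply _ _ _).symm)
    exact (Fintype.sum_equiv (e.trans (Equiv.inv G)) _ _
      fun j => actCodiag_apply (e j)⁻¹ ξ x).symm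

/-- An isomorphism commuting with two split idempotents restricts to an isomorphism between their
images. -/
theorem isIso_restrictPairing_forget {k : ℤ}
    (α : (toDerived C).obj (diag C) ⟶ (toDerived C).obj ((shift k).obj (codiag C))) [IsIso α]
    (hα : ∀ g, restrictPairing (ρ.F g⁻¹) α = α) : IsIso (restrictPairing (forget ρ) α) := by
  let Q := toDerived (Equivariant ρ)
  -- The products above are indexed by types in the lowest universe, so `G` is replaced by `Fin` of
  -- its cardinality.
  let e := (Fintype.equivFin G).symm
  let α' : Q.obj ((pullback (forget ρ)).obj (diag C)) ⟶
      Q.obj ((shift k).obj ((pullback (forget ρ)).obj (codiag C))) :=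
    (derivedPullback (forget ρ)).map α
  have : IsIso α' := inferInstanceAs (IsIso ((derivedPullback (forget ρ)).map α))
  let i := diagMap (forget ρ)
  let j := (shift k).map (codiagMap (forget ρ))
  let p := reynoldsDiag ρ
  let q := (shift k).map (reynoldsCodiag ρ)
  have hip : Q.map i ≫ Q.map p = 𝟙 _ := by
    rw [← Q.map_comp, diagMap_reynoldsDiag, Q.map_id]
  have hqj : Q.map q ≫ Q.map j = 𝟙 _ := by
    rw [← Q.map_comp, ← Functor.map_comp, reynoldsCodiag_codiagMap,
      CategoryTheory.Functor.map_id, Q.map_id]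
  have hcomm : α' ≫ Q.map j ≫ Q.map q = Q.map p ≫ Q.map i ≫ α' := by
    have h := derived_average_comm (fun x => actDiag ρ (e x))
      (fun x => (shift k).map (actCodiag ρ (e x)⁻¹)) α' fun x => pairing_comp_act α (e x) (hα _)
    rw [← reynoldsDiag_diagMap e, ← shift_codiagMap_reynoldsCodiag e k, Functor.map_comp,
      Functor.map_comp, Functor.map_comp, Category.assoc] at h
    exact h
  refine ⟨Q.map q ≫ inv α' ≫ Q.map p, ?_, ?_⟩
  · change (Q.map i ≫ α' ≫ Q.map j) ≫ Q.map q ≫ inv α' ≫ Q.map p = _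
    simp only [Category.assoc]
    rw [reassoc_of% hcomm, IsIso.hom_inv_id_assoc, reassoc_of% hip, hip]
  · change (Q.map q ≫ inv α' ≫ Q.map p) ≫ Q.map i ≫ α' ≫ Q.map j = _
    simp only [Category.assoc]
    rw [← reassoc_of% hcomm, IsIso.inv_hom_id_assoc, reassoc_of% hqj, hqj]

end Equivariant

end DG

/-! ### Zero objects, shifts and cones in `C_G` -/

namespace DG

open DGCategory DGBimod

section LeftMul

variable {C : Type u} [DGCategory C]

/-- The total space of morphisms of all degrees from `W` to `X`. -/
def totalHom (W X : C) : ModuleCat.{u} ℂ := ModuleCat.of ℂ (∀ j, (hom W X).X j)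

/-- Composition with `f` as an operator on the total spaces of morphisms from `W`. -/
def leftMul (W : C) {X Y : C} {i : ℤ} (f : (hom X Y).X i) : totalHom W X ⟶ totalHom W Y :=
  ModuleCat.ofHom (LinearMap.pi fun k => comp (show i + (k - i) = k by omega) f ∘ₗ
    LinearMap.proj (k - i))

theorem leftMul_one (W X : C) : leftMul W (one X) = 𝟙 _ := by
  apply ModuleCat.hom_ext
  refine LinearMap.ext fun (x : ∀ j, (hom W X).X j) => funext fun k => ?_
  have (a : ℤ) (h : 0 + a = k) : comp h (one X) (x a) = x k := by
    obtain rfl : a = k := by omega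
    exact one_comp _
  exact this _ _

/-- Graded composition becomes composition in an ordinary category, where reassociation needs no
degree proofs. With `leftMul_ext`, identities between long composites of mixed degrees can be
verified there. -/
theorem leftMul_comp (W : C) {X Y Z : C} {i j k : ℤ} (h : i + j = k) (g : (hom Y Z).X i)
    (f : (hom X Y).X j) : leftMul W (comp h g f) = leftMul W f ≫ leftMul W g := by
  apply ModuleCat.hom_ext
  refine LinearMap.ext fun (x : ∀ j, (hom W X).X j) => funext fun m => ?_
  have (a b c : ℤ) (hab : a = b) (h₃ : k + a = m) (h₂ : j + b = c) (h₄ : i + c = m) :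
      comp h₃ (comp h g f) (x a) = comp h₄ g (comp h₂ f (x b)) := by
    subst hab
    exact assoc _ _ _ _ _ _ _
  exact this _ _ _ (by omega) _ _ _

theorem leftMul_add (W : C) {X Y : C} {i : ℤ} (f g : (hom X Y).X i) :
    leftMul W (f + g) = leftMul W f + leftMul W g := by
  apply ModuleCat.hom_ext
  refine LinearMap.ext fun (x : ∀ j, (hom W X).X j) => funext fun m => ?_
  exact LinearMap.map_add₂ _ _ _ _

theorem leftMul_neg (W : C) {X Y : C} {i : ℤ} (f : (hom X Y).X i) :
    leftMul W (-f) = -leftMul W f := by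
  apply ModuleCat.hom_ext
  refine LinearMap.ext fun (x : ∀ j, (hom W X).X j) => funext fun m => ?_
  exact LinearMap.map_neg₂ _ _ _

theorem leftMul_zero (W : C) {X Y : C} {i : ℤ} :
    leftMul W (0 : (hom X Y).X i) = 0 := by
  apply ModuleCat.hom_ext
  refine LinearMap.ext fun (x : ∀ j, (hom W X).X j) => funext fun m => ?_
  exact LinearMap.map_zero₂ _ _

/-- A morphism is determined by composition with it. -/
theorem leftMul_ext {X Y : C} {i : ℤ} {f g : (hom X Y).X i}
    (h : ∀ W, leftMul W f = leftMul W g) : f = g := by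
  -- The Yoneda argument: evaluate at the identity of `X`, placed in degree `0`.
  have h' := congrFun (congrArg (fun α => α.hom (Pi.single 0 (one X) : ∀ j, (hom X X).X j)) (h X)) i
  have (a : ℤ) (ha : i + a = i) (f : (hom X Y).X i) :
      comp ha f ((Pi.single 0 (one X) : ∀ j, (hom X X).X j) a) = f := by
    obtain rfl : a = 0 := by omega
    rw [Pi.single_eq_same, comp_one]
  exact (this _ _ f).symm.trans (h'.trans (this _ _ g))

theorem leftMul_map_comp {D : Type u} [DGCategory D] (F : DGFunctor C D) (W : D) {X Y Z : C}
    {i j k : ℤ} {h : i + j = k} {g : (hom Y Z).X i} {f : (hom X Y).X j} {r : (hom X Z).X k}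
    (e : comp h g f = r) :
    leftMul W (((F.map X Y).f j).hom f) ≫ leftMul W (((F.map Y Z).f i).hom g) =
      leftMul W (((F.map X Z).f k).hom r) := by
  rw [← e, F.map_comp, leftMul_comp]

theorem closed_of_d_succ {X Y : C} {i : ℤ} {f : (hom X Y).X i}
    (h : ((hom X Y).d i (i + 1)).hom f = 0) (j : ℤ) : ((hom X Y).d i j).hom f = 0 := by
  by_cases hj : i + 1 = j
  · subst hj
    exact h
  · simp [(hom X Y).shape i j hj]

theorem closed_comp {X Y Z : C} {i j k : ℤ} (h : i + j = k) {g : (hom Y Z).X i}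
    {f : (hom X Y).X j} (hg : ∀ i', ((hom Y Z).d i i').hom g = 0)
    (hf : ∀ j', ((hom X Y).d j j').hom f = 0) (k' : ℤ) :
    ((hom X Z).d k k').hom (comp h g f) = 0 := by
  refine closed_of_d_succ ?_ k'
  rw [leibniz h (show i + 1 + j = k + 1 by omega) (show i + (j + 1) = k + 1 by omega) rfl rfl, hg,
    hf]
  simp

end LeftMul

namespace Equivariant

variable {G : Type u} [Group G] {C : Type u} [DGCategory C] {ρ : DGAction G C}

/-- The zero object of `C` with its linearization. -/
def ofZero (ρ : DGAction G C) {Z : C} (hZ : one Z = 0) : Equivariant ρ where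
  obj := Z
  φ _ := 0
  isDGIso_φ g := by
    have h : one ((ρ.F g).obj Z) = 0 := by rw [← (ρ.F g).map_one, hZ, map_zero]
    exact ⟨map_zero _, 0, by simp [hZ], by simp [h]⟩
  cocycle e := by simp

section Shift

variable (A : Equivariant ρ) {Y : C} {k l : ℤ} (hlk : l + k = 0) (hkl : k + l = 0)
  (s : (hom A.obj Y).X k) (t : (hom Y A.obj).X l)

/-- The isomorphism `Y → ρ_g Y` given by a linearization of `A` and mutually inverse morphisms
`s : A → Y` and `t : Y → A`. -/
def shiftφ (g : G) : (hom Y ((ρ.F g).obj Y)).X 0 :=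
  comp hkl (comp (add_zero k) ((((ρ.F g).map _ _).f k).hom s) (A.φ g)) t

/-- The linearization `ρ_g(s) φ_g t` is designed to make `s` invariant; `map_comp_shiftφ` is the
invariance of `t`. -/
theorem shiftφ_comp (hts : comp hlk t s = one A.obj) (g : G) :
    comp (zero_add k) (shiftφ A hkl s t g) s =
      comp (add_zero k) ((((ρ.F g).map _ _).f k).hom s) (A.φ g) := by
  refine leftMul_ext fun W => ?_
  have h := congrArg (leftMul W) hts
  simp only [shiftφ, leftMul_comp, leftMul_one] at h ⊢
  rw [reassoc_of% h]

theorem map_comp_shiftφ (hts : comp hlk t s = one A.obj) (g : G) :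
    comp (zero_add l) (A.φ g) t =
      comp (add_zero l) ((((ρ.F g).map _ _).f l).hom t) (shiftφ A hkl s t g) := by
  refine leftMul_ext fun W => ?_
  have h := leftMul_map_comp (ρ.F g) W hts
  simp only [shiftφ, leftMul_comp, leftMul_one, DGFunctor.map_one, Category.assoc] at h ⊢
  rw [h, Category.comp_id]

/-- The linearization of a shift of a linearized object. -/
def ofShift (hs : ∀ i, ((hom A.obj Y).d k i).hom s = 0) (ht : ∀ i, ((hom Y A.obj).d l i).hom t = 0)
    (hts : comp hlk t s = one A.obj) (hst : comp hkl s t = one Y) : Equivariant ρ where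
  obj := Y
  φ := shiftφ A hkl s t
  isDGIso_φ g := by
    refine ⟨closed_comp _ (closed_comp _ (fun i => ?_) (closed_of_d_succ (A.d_φ g))) ht 1,
      comp hkl s (comp (zero_add l) (A.ψ g) ((((ρ.F g).map _ _).f l).hom t)), ?_, ?_⟩
    · rw [← DGFunctor.map_d, hs, map_zero]
    all_goals
      refine leftMul_ext fun W => ?_
      have h₁ := leftMul_map_comp (ρ.F g) W hts
      have h₂ := leftMul_map_comp (ρ.F g) W hst
      have h₃ := congrArg (leftMul W) hts
      have h₄ := congrArg (leftMul W) hst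
      have h₅ := congrArg (leftMul W) (A.φ_ψ g)
      have h₆ := congrArg (leftMul W) (A.ψ_φ g)
      simp only [leftMul_comp, leftMul_one, DGFunctor.map_one] at h₁ h₂ h₃ h₄ h₅ h₆
      simp only [shiftφ, leftMul_comp, leftMul_one]
      simp [h₂, h₄, reassoc_of% h₁, reassoc_of% h₃, reassoc_of% h₅, reassoc_of% h₆]
  cocycle {g h k} e := by
    refine leftMul_ext fun W => ?_
    have h₁ := leftMul_map_comp (ρ.F g) W hts
    have h₂ := congrArg (leftMul W) (A.cocycle e)
    have h₃ := congrArg (leftMul W) (ρ.naturality e s)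
    simp only [leftMul_comp, leftMul_one, DGFunctor.map_one, Category.assoc] at h₁ h₂ h₃
    simp only [shiftφ, leftMul_comp, DGFunctor.map_comp, Category.assoc]
    rw [h₂]
    simp [← h₃, reassoc_of% h₁]

end Shift

/-- The data of a cone `Z` of a closed morphism `f : X → Y` of degree `0`. -/
structure ConeData {C : Type u} [DGCategory C] {X Y : C} (f : (hom X Y).X 0) where
  Z : C
  i : (hom Y Z).X 0
  q : (hom Z Y).X 0
  j : (hom X Z).X (-1)
  p : (hom Z X).X 1
  qi : comp (add_zero 0) q i = one Y
  pj : comp (add_neg_cancel 1) p j = one X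
  pi : comp (add_zero 1) p i = 0
  qj : comp (zero_add (-1)) q j = 0
  total : comp (add_zero 0) i q + comp (neg_add_cancel 1) j p = one Z
  d_i : ((hom Y Z).d 0 1).hom i = 0
  d_j : ((hom X Z).d (-1) 0).hom j = comp (add_zero 0) i f

namespace ConeData

variable {X Y : C} {f : (hom X Y).X 0} (K : ConeData f)

/-- The differential of `i q + j p = 1`. Composing it with `p` and with `q` determines `dp` and
`dq`, which are not part of the cone data. -/
theorem d_total : comp (zero_add 1) K.i (((hom _ _).d 0 1).hom K.q) +
    comp (zero_add 1) (comp (add_zero 0) K.i f) K.p +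
      (-comp (show -1 + 2 = 1 by rfl) K.j (((hom _ _).d 1 2).hom K.p)) = 0 := by
  have h := congrArg (((hom K.Z K.Z).d 0 1).hom) K.total
  rw [map_add, d_one, d_closed_comp _ K.d_i, leibniz (neg_add_cancel 1) (zero_add 1)
    (show -1 + 2 = 1 by rfl) (neg_add_cancel 1) (show (1 : ℤ) + 1 = 2 by rfl), K.d_j] at h
  simpa [add_assoc] using h

theorem d_p : ((hom _ _).d 1 2).hom K.p = 0 := by
  refine leftMul_ext fun W => ?_
  have h := congrArg (fun x => leftMul W x ≫ leftMul W K.p) K.d_total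
  have h₁ := congrArg (leftMul W) K.pi
  have h₂ := congrArg (leftMul W) K.pj
  simp only [leftMul_comp, leftMul_one, leftMul_zero, leftMul_add, leftMul_neg] at h h₁ h₂ ⊢
  simpa [h₁, h₂] using h

theorem d_q : ((hom _ _).d 0 1).hom K.q = -comp (zero_add 1) f K.p := by
  refine leftMul_ext fun W => ?_
  have h := congrArg (fun x => leftMul W x ≫ leftMul W K.q) K.d_total
  have h₁ := congrArg (leftMul W) K.qi
  have h₂ := congrArg (leftMul W) K.qj
  rw [K.d_p] at h
  simp only [leftMul_comp, leftMul_one, leftMul_zero, leftMul_add, leftMul_neg] at h h₁ h₂ ⊢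
  rw [eq_neg_iff_add_eq_zero]
  simpa [h₁, h₂] using h

end ConeData

section Cone

variable {A B : Equivariant ρ} {f : invariants A B 0} (K : ConeData f.1)

/-- The isomorphism `Z → ρ_g Z` for the cone `Z` of an invariant morphism. -/
def coneφ (g : G) : (hom K.Z ((ρ.F g).obj K.Z)).X 0 :=
  comp (add_zero 0) (comp (add_zero 0) ((((ρ.F g).map _ _).f 0).hom K.i) (B.φ g)) K.q +
    comp (neg_add_cancel 1) (comp (add_zero (-1)) ((((ρ.F g).map _ _).f (-1)).hom K.j) (A.φ g)) K.p

/-- `coneφ` is diagonal for the graded decomposition of the cone into `B` and a shift of `A`. This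
lemma and the next three say that all four structure maps are invariant. -/
theorem coneφ_comp_i (g : G) : comp (zero_add 0) (coneφ K g) K.i =
    comp (add_zero 0) ((((ρ.F g).map _ _).f 0).hom K.i) (B.φ g) := by
  refine leftMul_ext fun W => ?_
  have h₁ := congrArg (leftMul W) K.qi
  have h₂ := congrArg (leftMul W) K.pi
  simp only [coneφ, leftMul_comp, leftMul_add, leftMul_one, leftMul_zero] at h₁ h₂ ⊢
  simp [reassoc_of% h₁, reassoc_of% h₂]

theorem coneφ_comp_j (g : G) : comp (zero_add (-1)) (coneφ K g) K.j =
    comp (add_zero (-1)) ((((ρ.F g).map _ _).f (-1)).hom K.j) (A.φ g) := by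
  refine leftMul_ext fun W => ?_
  have h₁ := congrArg (leftMul W) K.qj
  have h₂ := congrArg (leftMul W) K.pj
  simp only [coneφ, leftMul_comp, leftMul_add, leftMul_one, leftMul_zero] at h₁ h₂ ⊢
  simp [reassoc_of% h₁, reassoc_of% h₂]

theorem q_comp_coneφ (g : G) : comp (zero_add 0) (B.φ g) K.q =
    comp (add_zero 0) ((((ρ.F g).map _ _).f 0).hom K.q) (coneφ K g) := by
  refine leftMul_ext fun W => ?_
  have h₁ := leftMul_map_comp (ρ.F g) W K.qi
  have h₂ := leftMul_map_comp (ρ.F g) W K.qj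
  simp only [map_zero, DGFunctor.map_one, leftMul_one, leftMul_zero] at h₁ h₂
  simp only [coneφ, leftMul_comp, leftMul_add]
  simp [h₁, h₂]

theorem p_comp_coneφ (g : G) : comp (zero_add 1) (A.φ g) K.p =
    comp (add_zero 1) ((((ρ.F g).map _ _).f 1).hom K.p) (coneφ K g) := by
  refine leftMul_ext fun W => ?_
  have h₁ := leftMul_map_comp (ρ.F g) W K.pi
  have h₂ := leftMul_map_comp (ρ.F g) W K.pj
  simp only [map_zero, DGFunctor.map_one, leftMul_one, leftMul_zero] at h₁ h₂
  simp only [coneφ, leftMul_comp, leftMul_add]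
  simp [h₁, h₂]

/-- The linearization of the cone of an invariant morphism. -/
def ofCone : Equivariant ρ where
  obj := K.Z
  φ := coneφ K
  isDGIso_φ g := by
    refine ⟨?_, comp (add_zero 0) K.i (comp (add_zero 0) (B.ψ g) ((((ρ.F g).map _ _).f 0).hom K.q))
      + comp (neg_add_cancel 1) K.j (comp (zero_add 1) (A.ψ g)
        ((((ρ.F g).map _ _).f 1).hom K.p)), ?_, ?_⟩
    · have hi : ((hom _ _).d 0 1).hom
          (comp (add_zero 0) ((((ρ.F g).map _ _).f 0).hom K.i) (B.φ g)) = 0 := by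
        rw [d_comp_closed _ (B.d_φ g), ← DGFunctor.map_d, K.d_i]
        simp
      rw [coneφ, map_add, d_closed_comp _ hi, leibniz (neg_add_cancel 1) (zero_add 1)
        (show -1 + 2 = 1 by rfl) (neg_add_cancel 1) (show (1 : ℤ) + 1 = 2 by rfl), K.d_p, K.d_q,
        d_comp_closed _ (A.d_φ g), ← DGFunctor.map_d, K.d_j]
      refine leftMul_ext fun W => ?_
      -- The differential of `coneφ` is `ρ_g(i) (ρ_g(f) φ_g - φ_g f) p`, which vanishes because `f`
      -- is invariant.
      have h := congrArg (leftMul W) (f.2 g)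
      simp only [map_zero, smul_zero, add_zero, leftMul_comp, leftMul_zero, leftMul_add,
        leftMul_neg, DGFunctor.map_comp] at h ⊢
      simp [reassoc_of% h]
    all_goals
      refine leftMul_ext fun W => ?_
      have h₁ := leftMul_map_comp (ρ.F g) W K.qi
      have h₂ := leftMul_map_comp (ρ.F g) W K.pj
      have h₃ := leftMul_map_comp (ρ.F g) W K.pi
      have h₄ := leftMul_map_comp (ρ.F g) W K.qj
      have h₅ := congrArg (fun x => leftMul W ((((ρ.F g).map _ _).f 0).hom x)) K.total
      have k₁ := congrArg (leftMul W) K.qi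
      have k₂ := congrArg (leftMul W) K.pj
      have k₃ := congrArg (leftMul W) K.pi
      have k₄ := congrArg (leftMul W) K.qj
      have k₅ := congrArg (leftMul W) K.total
      have a₁ := congrArg (leftMul W) (A.φ_ψ g)
      have a₂ := congrArg (leftMul W) (A.ψ_φ g)
      have b₁ := congrArg (leftMul W) (B.φ_ψ g)
      have b₂ := congrArg (leftMul W) (B.ψ_φ g)
      simp only [leftMul_comp, leftMul_one, leftMul_zero, leftMul_add, map_add, map_zero,
        DGFunctor.map_one, DGFunctor.map_comp] at h₁ h₂ h₃ h₄ h₅ k₁ k₂ k₃ k₄ k₅ a₁ a₂ b₁ b₂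
      simp only [coneφ, leftMul_comp, leftMul_add, leftMul_one]
      simp [h₅, k₅, reassoc_of% h₁, reassoc_of% h₂, reassoc_of% h₃, reassoc_of% h₄,
        reassoc_of% k₁, reassoc_of% k₂, reassoc_of% k₃, reassoc_of% k₄,
        reassoc_of% a₁, reassoc_of% a₂, reassoc_of% b₁, reassoc_of% b₂]
  cocycle {g h k} e := by
    refine leftMul_ext fun W => ?_
    have h₁ := leftMul_map_comp (ρ.F g) W K.qi
    have h₂ := leftMul_map_comp (ρ.F g) W K.pj
    have h₃ := leftMul_map_comp (ρ.F g) W K.pi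
    have h₄ := leftMul_map_comp (ρ.F g) W K.qj
    have a := congrArg (leftMul W) (A.cocycle e)
    have b := congrArg (leftMul W) (B.cocycle e)
    have i := congrArg (leftMul W) (ρ.naturality e K.i)
    have j := congrArg (leftMul W) (ρ.naturality e K.j)
    simp only [leftMul_comp, leftMul_one, leftMul_zero, map_zero,
      DGFunctor.map_one] at h₁ h₂ h₃ h₄ a b i j
    simp only [coneφ, leftMul_comp, leftMul_add, DGFunctor.map_comp,
      map_add (((ρ.F g).map _ _).f _).hom]
    rw [a, b]
    simp [← i, ← j, reassoc_of% h₁, reassoc_of% h₂, reassoc_of% h₃, reassoc_of% h₄]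

end Cone

theorem isPretriangulated (hC : IsPretriangulated C) : IsPretriangulated (Equivariant ρ) where
  zero := by
    obtain ⟨Z, hZ⟩ := hC.zero
    exact ⟨ofZero ρ hZ, Subtype.ext hZ⟩
  shift A k := by
    obtain ⟨Y, s, t, hs, ht, hts, hst⟩ := hC.shift A.obj k
    exact ⟨ofShift A (neg_add_cancel k) (add_neg_cancel k) s t (closed_of_d_succ hs)
      (closed_of_d_succ ht) hts hst, ⟨s, shiftφ_comp A _ _ s t hts⟩,
      ⟨t, map_comp_shiftφ A _ _ s t hts⟩, Subtype.ext hs, Subtype.ext ht, Subtype.ext hts,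
      Subtype.ext hst⟩
  cone {A B} f hf := by
    obtain ⟨Z, i, q, j, p, qi, pj, pi, qj, total, d_i, d_j⟩ := hC.cone f.1 (congrArg Subtype.val hf)
    let K : ConeData f.1 := ⟨Z, i, q, j, p, qi, pj, pi, qj, total, d_i, d_j⟩
    exact ⟨ofCone K, ⟨i, coneφ_comp_i K⟩, ⟨q, q_comp_coneφ K⟩, ⟨j, coneφ_comp_j K⟩,
      ⟨p, p_comp_coneφ K⟩, Subtype.ext qi, Subtype.ext pj, Subtype.ext pi, Subtype.ext qj,
      Subtype.ext total, Subtype.ext d_i, Subtype.ext d_j⟩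

end Equivariant

end DG

/-! ### The shift `[n]` as a Serre functor -/

namespace DG

open DGCategory DGBimod

theorem quasiIso_of_bijective {K L : Cx.{u}} (α : K ⟶ L)
    (h : ∀ i, Function.Bijective (α.f i).hom) : QuasiIso α := by
  have (i : ℤ) : IsIso (α.f i) := (ConcreteCategory.isIso_iff_bijective (α.f i)).2 (h i)
  have : IsIso α := HomologicalComplex.Hom.isIso_of_components α
  infer_instance

namespace DGBimod

variable {C : Type u} [DGCategory C]

/-- The identification of a dg-bimodule `M` with `M[l][k]` for `k + l = 0`. -/
def toShiftShift (M : DGBimod C) {k l : ℤ} (h : k + l = 0) : M ⟶ shiftObj k (shiftObj l M) where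
  app X Y :=
    { f := fun i => ((M.obj X Y).XIsoOfEq (show i = i + k + l by omega)).hom
      comm' := fun i j _ => by
        change _ ≫ (k.negOnePow • l.negOnePow • (M.obj X Y).d (i + k + l) (j + k + l)) = _
        rw [smul_smul, ← Int.negOnePow_add, h, Int.negOnePow_zero, one_smul,
          HomologicalComplex.XIsoOfEq_hom_comp_d]
        exact (HomologicalComplex.d_comp_XIsoOfEq_hom _ _ _).symm }
  map_lact {X Y Z i j m} e g x := by
    have (a b : ℤ) (ha : j = a) (hb : m = b) (e' : i + a = b) :
        ((M.obj X Z).XIsoOfEq hb).hom.hom (M.lact e g x) =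
          M.lact e' g (((M.obj X Y).XIsoOfEq ha).hom.hom x) := by
      subst ha hb
      rfl
    have hs (y : (M.obj X Z).X (m + k + l)) :
        (k * i).negOnePow • (l * i).negOnePow • y = y := by
      rw [smul_smul, ← Int.negOnePow_add, ← add_mul, h, zero_mul, Int.negOnePow_zero, one_smul]
    exact (this (j + k + l) (m + k + l) (by omega) (by omega) (by omega)).trans (hs _).symm
  map_ract {X Y Z i j m} e x f := by
    have (a b : ℤ) (ha : i = a) (hb : m = b) (e' : a + j = b) :
        ((M.obj X Z).XIsoOfEq hb).hom.hom (M.ract e x f) =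
          M.ract e' (((M.obj Y Z).XIsoOfEq ha).hom.hom x) f := by
      subst ha hb
      rfl
    exact this (i + k + l) (m + k + l) (by omega) (by omega) (by omega)

theorem quasiIso_toShiftShift (M : DGBimod C) {k l : ℤ} (h : k + l = 0) :
    quasiIso C (toShiftShift M h) := fun X Y => quasiIso_of_bijective _ fun i =>
  (ConcreteCategory.isIso_iff_bijective
    ((M.obj X Y).XIsoOfEq (show i = i + k + l by omega)).hom).1 inferInstance

/-- The isomorphism `M ≅ M[l][k]` in the derived category for `k + l = 0`. -/
def shiftShiftIso (M : DGBimod C) {k l : ℤ} (h : k + l = 0) :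
    (toDerived C).obj M ≅ (toDerived C).obj ((shift k).obj ((shift l).obj M)) :=
  Localization.Construction.wIso (toShiftShift M h) (quasiIso_toShiftShift M h)

/-- Composition with `v` inverts composition with `u` on the nose, so the two evaluation maps are
even isomorphisms of complexes. The degree `0 + k` is degree `0` of the shifted complex. -/
theorem isBiuniversal_shift_diag {k l : ℤ} {Z Y : C} (u : (hom Z Y).X (0 + k))
    (v : (hom Y Z).X l) (hu : ∀ j, ((hom Z Y).d (0 + k) j).hom u = 0) (hlk : l + (0 + k) = 0)
    (hkl : 0 + k + l = 0) (hvu : comp hlk v u = one Z) (huv : comp hkl u v = one Y) :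
    IsBiuniversal (shiftObj k (diag C)) (Z := Z) (Y := Y) u := by
  have hu' : k.negOnePow • ((hom Z Y).d (0 + k) (1 + k)).hom u = 0 := by rw [hu, smul_zero]
  refine ⟨hu',
    fun X => quasiIso_of_bijective _ fun i => ?_, fun X => quasiIso_of_bijective _ fun i => ?_⟩
  · have e : 0 + k + i = i + k := by omega
    have e' : l + (i + k) = i := by omega
    refine Function.bijective_iff_has_inverse.2 ⟨fun m => comp e' v m, fun f => ?_,
      fun (m : (hom X Y).X (i + k)) => ?_⟩
    · change comp e' v (comp e u f) = f
      rw [← assoc hlk e (zero_add i) e', hvu, one_comp]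
    · change comp e u (comp e' v m) = m
      rw [← assoc hkl e' (zero_add _) e, huv, one_comp]
  · have e : i + (0 + k) = i + k := by omega
    have e' : i + k + l = i := by omega
    -- The left action on the shift carries this sign, so the inverse must carry it too.
    have hs : (k * i).negOnePow * (k * i).negOnePow = 1 := by
      rw [← Int.negOnePow_add, ← two_mul, Int.negOnePow_two_mul]
    refine Function.bijective_iff_has_inverse.2
      ⟨fun m => (k * i).negOnePow • comp e' m v, fun f => ?_,
        fun (m : (hom Z X).X (i + k)) => ?_⟩
    · change (k * i).negOnePow • comp e' ((k * i).negOnePow • comp e f u) v = f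
      rw [Units.smul_def (k * i).negOnePow (comp e f u), map_zsmul, LinearMap.smul_apply,
        ← Units.smul_def, smul_smul, hs, one_smul, assoc e hkl e' (add_zero i), huv, comp_one]
    · change (k * i).negOnePow • comp e ((k * i).negOnePow • comp e' m v) u = m
      rw [Units.smul_def (k * i).negOnePow (comp e' m v), map_zsmul, LinearMap.smul_apply,
        ← Units.smul_def, smul_smul, hs, one_smul, assoc e' hlk e (add_zero _), hvu, comp_one]

end DGBimod

/-- Here the target is prescribed: shift `Y` by the opposite degree and exchange the two structure
maps. -/
theorem IsPretriangulated.exists_shift_to {C : Type u} [DGCategory C] (hC : IsPretriangulated C)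
    (Y : C) (k l : ℤ) (hlk : l + k = 0) (hkl : k + l = 0) :
    ∃ (Z : C) (u : (hom Z Y).X k) (v : (hom Y Z).X l),
      (∀ j, ((hom Z Y).d k j).hom u = 0) ∧ comp hlk v u = one Z ∧ comp hkl u v = one Y := by
  obtain rfl : k = -l := by omega
  obtain ⟨Z, v, u, -, hu, huv, hvu⟩ := hC.shift Y l
  exact ⟨Z, u, v, closed_of_d_succ hu, hvu, huv⟩

/-- The Serre functor `[n]` on a pre-triangulated dg-category with an isomorphism
`C(X, Y) ≅ C(Y, X)^∨[-n]`. -/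
def SerreFunctor.ofIso {C : Type u} [DGCategory C] (hC : IsPretriangulated C)
    (hfin : ∀ (X Y : C) (i : ℤ), Module.Finite ℂ ((hom X Y).homology i)) (n : ℤ)
    (α : (toDerived C).obj (diag C) ≅ (toDerived C).obj ((shift (-n)).obj (codiag C))) :
    SerreFunctor C where
  finite := hfin
  bimod := (shift n).obj (diag C)
  repr Y := by
    obtain ⟨Z, u, v, hu, hvu, huv⟩ := hC.exists_shift_to Y (0 + n) (-n) (by omega) (by omega)
    exact ⟨Z, u, isBiuniversal_shift_diag u v hu _ _ hvu huv⟩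
  essSurj Z := by
    obtain ⟨Y, u, v, hu, -, hvu, huv⟩ := hC.shift Z (0 + n)
    exact ⟨Y, u, isBiuniversal_shift_diag u v (closed_of_d_succ hu) _ _ hvu huv⟩
  duality := (derivedShift C n).mapIso α ≪≫ (shiftShiftIso (codiag C) (add_neg_cancel n)).symm

/-- All the content sits in the duality of `SerreFunctor.ofIso`; the Calabi–Yau class is then the
canonical isomorphism `id ≅ id[n][-n]`. -/
theorem IsCalabiYau.of_iso {C : Type u} [DGCategory C] (hC : IsPretriangulated C)
    (hfin : ∀ (X Y : C) (i : ℤ), Module.Finite ℂ ((hom X Y).homology i)) (n : ℤ)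
    (α : (toDerived C).obj (diag C) ≅ (toDerived C).obj ((shift (-n)).obj (codiag C))) :
    IsCalabiYau C n :=
  ⟨hC, SerreFunctor.ofIso hC hfin n α, (shiftShiftIso (diag C) (neg_add_cancel n)).hom,
    Iso.isIso_hom (shiftShiftIso (diag C) (neg_add_cancel n))⟩

/-! ### Finiteness of homology and invariance under characters -/

namespace Equivariant

variable {G : Type u} [Group G] {C : Type u} [DGCategory C] {ρ : DGAction G C}

/-- Averaging makes the homology of invariant morphisms a direct summand of the homology of all
morphisms. -/
theorem finite_homology [Fintype G]
    (h : ∀ (X Y : C) (i : ℤ), Module.Finite ℂ ((hom X Y).homology i))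
    (A B : Equivariant ρ) (i : ℤ) : Module.Finite ℂ ((hom A B).homology i) := by
  have := h A.obj B.obj i
  let ι : hom A B ⟶ hom A.obj B.obj := (diagMap (forget ρ)).app A B
  let π : hom A.obj B.obj ⟶ hom A B := (reynoldsDiag ρ).app A B
  have hιπ : ι ≫ π = 𝟙 _ := congrArg (fun α => Hom.app α A B) (diagMap_reynoldsDiag (ρ := ρ))
  have h' : HomologicalComplex.homologyMap ι i ≫ HomologicalComplex.homologyMap π i = 𝟙 _ := by
    rw [← HomologicalComplex.homologyMap_comp, hιπ, HomologicalComplex.homologyMap_id]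
  refine Module.Finite.of_injective (HomologicalComplex.homologyMap ι i).hom ?_
  refine Function.LeftInverse.injective (g := (HomologicalComplex.homologyMap π i).hom) fun x => ?_
  exact congrArg (fun α => α.hom x) h'

/-- The pullbacks of a bimodule along the forgetful functor and along its composite with the twist
by a character agree. -/
def twistPullback (ρ : DGAction G C) (χ : G →* ℂˣ) :
    pullback (forget ρ) ⟶ pullback (forget ρ) ⋙ pullback (twistFunctor ρ χ) where
  app M := { app := fun A B => 𝟙 (M.obj A.obj B.obj), map_lact _ _ _ := rfl, map_ract _ _ _ := rfl }
  naturality _ _ _ := rfl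

theorem comp_eq_of_naturality {E : Type*} [Category E] {L L' M M' N N' P P' : E} {a : M ⟶ N}
    {a' : M' ⟶ N'} {l : M ⟶ M'} {l' : N ⟶ N'} {d : L ⟶ M} {d₁ : L ⟶ L'} {d₂ : L' ⟶ M'} {c : N ⟶ P}
    {c₁ : N' ⟶ P'} {c₂ : P' ⟶ P} (h : a ≫ l' = l ≫ a') (hd : d₁ ≫ d₂ = d ≫ l)
    (hc : l' ≫ c₁ ≫ c₂ = c) : d₁ ≫ (d₂ ≫ a' ≫ c₁) ≫ c₂ = d ≫ a ≫ c := by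
  rw [Category.assoc, Category.assoc, reassoc_of% hd, ← reassoc_of% h, hc]

/-- Restriction of pairings is functorial, and `p ∘ χ = p` since a twist alters only the
linearization; `twistPullback` records the resulting identification of pullbacks. -/
theorem restrictPairing_twistFunctor (χ : G →* ℂˣ) {k : ℤ}
    (α : (toDerived C).obj (diag C) ⟶ (toDerived C).obj ((shift k).obj (codiag C))) :
    restrictPairing (twistFunctor ρ χ) (restrictPairing (forget ρ) α) =
      restrictPairing (forget ρ) α := by
  let Q := toDerived (Equivariant ρ)
  let DP := derivedPullback (forget ρ)
  let DT := derivedPullback (twistFunctor ρ χ)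
  let t := twistPullback ρ χ
  let c := (shift k).map (codiagMap (forget ρ))
  let c' := (shift k).map (codiagMap (twistFunctor ρ χ))
  have h₁ : DP.map α ≫ Q.map (t.app ((shift k).obj (codiag C))) =
      Q.map (t.app (diag C)) ≫ DT.map (DP.map α) :=
    (derivedMap_naturality (fun _ _ _ h X Y => h _ _) (fun _ _ _ h X Y => h _ _) t α).trans
      (congrArg (Q.map (t.app (diag C)) ≫ ·) (derivedMap_comp _ _ _ _ α).symm)
  have h₂ : Q.map (diagMap (twistFunctor ρ χ)) ≫ DT.map (Q.map (diagMap (forget ρ))) =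
      Q.map (diagMap (forget ρ)) ≫ Q.map (t.app (diag C)) :=
    (congrArg (Q.map (diagMap (twistFunctor ρ χ)) ≫ ·) (derivedPullback_map _ _)).trans
      ((Q.map_comp _ _).symm.trans (Q.map_comp (diagMap (forget ρ)) (t.app (diag C))))
  have h₃ : Q.map (t.app ((shift k).obj (codiag C))) ≫ DT.map (Q.map c) ≫ Q.map c' = Q.map c :=
    (congrArg (fun x => Q.map (t.app ((shift k).obj (codiag C))) ≫ x ≫ Q.map c')
      (derivedPullback_map _ _)).trans
        ((congrArg (Q.map (t.app ((shift k).obj (codiag C))) ≫ ·) (Q.map_comp _ _).symm).trans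
          (Q.map_comp _ _).symm)
  have h₄ : DT.map (restrictPairing (forget ρ) α) =
      DT.map (Q.map (diagMap (forget ρ))) ≫ DT.map (DP.map α) ≫ DT.map (Q.map c) :=
    (DT.map_comp _ _).trans (congrArg _ (DT.map_comp _ _))
  exact (congrArg (fun x => Q.map (diagMap (twistFunctor ρ χ)) ≫ x ≫ Q.map c') h₄).trans
    (comp_eq_of_naturality h₁ h₂ h₃)

end Equivariant

end DG

end

theorem mainTheorem6 {C : Type u} [DG.DGCategory C] {G : Type u} [Group G] [Finite G]
    (ρ : DG.DGAction G C) (hC : DG.IsPretriangulated C) (n : ℤ) (S : DG.SerreFunctor C)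
    (a : DG.HH S.bimod (-n)) (ha : CategoryTheory.IsIso a) (hinv : ∀ g : G, ρ.actHH S g a = a) :
    DG.IsCalabiYau (DG.Equivariant ρ) n ∧
      ∀ T : DG.SerreFunctor (DG.Equivariant ρ),
        CategoryTheory.IsIso (DG.pullHH (DG.Equivariant.forget ρ) S T a) ∧
        ∀ χ : G →* ℂˣ,
          (DG.Equivariant.dualAction ρ).actHH T χ (DG.pullHH (DG.Equivariant.forget ρ) S T a) =
            DG.pullHH (DG.Equivariant.forget ρ) S T a := by
  have := Fintype.ofFinite G
  let α : (DG.DGBimod.toDerived C).obj (DG.DGBimod.diag C) ⟶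
      (DG.DGBimod.toDerived C).obj ((DG.DGBimod.shift (-n)).obj (DG.DGBimod.codiag C)) :=
    a ≫ (DG.DGBimod.derivedShift C (-n)).map S.duality.hom
  have hS : IsIso ((DG.DGBimod.derivedShift C (-n)).map S.duality.hom) := inferInstance
  have : IsIso α := IsIso.comp_isIso' ha hS
  -- Composing the invariance of `a` with duality turns it into invariance of the pairing.
  have hα (g : G) : DG.DGBimod.restrictPairing (ρ.F g⁻¹) α = α :=
    (DG.DGBimod.pullHH_comp_duality _ _ _ _).symm.trans
      (congrArg (· ≫ (DG.DGBimod.derivedShift C (-n)).map S.duality.hom) (hinv g))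
  have hiso := DG.Equivariant.isIso_restrictPairing_forget α hα
  refine ⟨DG.IsCalabiYau.of_iso (DG.Equivariant.isPretriangulated hC)
    (DG.Equivariant.finite_homology S.finite) n
    (asIso (DG.DGBimod.restrictPairing (DG.Equivariant.forget ρ) α)), fun T => ⟨?_, fun χ => ?_⟩⟩
  · have hT : IsIso ((DG.DGBimod.derivedShift _ (-n)).map T.duality.inv) := inferInstance
    rw [DG.DGBimod.pullHH_eq]
    exact IsIso.comp_isIso' hiso hT
  · refine (DG.DGBimod.pullHH_eq _ _ _ _).trans (Eq.trans ?_ (DG.DGBimod.pullHH_eq _ _ _ _).symm)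
    refine congrArg (· ≫ (DG.DGBimod.derivedShift _ (-n)).map T.duality.inv) ?_
    -- Conjugation by `χ` is restriction along the twist by `χ⁻¹`.
    refine Eq.trans ?_ (DG.Equivariant.restrictPairing_twistFunctor χ⁻¹ α)
    exact congrArg _ (DG.DGBimod.pullHH_comp_duality _ _ _ _)
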